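/- \textbf{Theorem.} For $k=(k_1,\dots,k_M)\in\mathbb Z_{>0}^M$, $a\in\mathbb R^M$ and a time-dependent Hamiltonian $H$ on $[t_0,t_0+\Delta t]$, the midpoint-based multiproduct formula is $$U_{k}(t_0+\Delta t,t_0)=\sum_{j=1}^M a_j\,U_2^{(k_j)}(t_0+\Delta t,t_0),\qquad U_2^{(m)}(t_0+\Delta t,t_0)=\prod_{q=1}^{m}U_2\!\left(t_0+\tfrac{q\Delta t}{m},\,t_0+\tfrac{(q-1)\Delta t}{m}\right),$$ where later times stand to the left in the product and $U_2(s+\delta,s)=\exp\!\big(-iH(s+\delta/2)\,\delta\big)$. Write $\|a\|_1=\sum_j|a_j|$ and let $\|\cdot\|$ be the spectral norm. One can choose, for every integer $M\ge 1$, vectors $k=k^{(M)}\in\mathbb Z_{>0}^M$ and $a=a^{(M)}\in\mathbb R^M$, depending only on $M$, such that $$\|a^{(M)}\|_1=O(\log M),\qquad \max_j k^{(M)}_j=O(M^2)\qquad(M\to\infty),$$ and such that for every $M\ge1$ the Vandermonde equations $\sum_j a_j=1$ and $\sum_j a_j k_j^{-2l}=0$ $(1\le l\le M-1)$ hold together with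 the following error bound. Let $n\ge 0$ be an integer, $t_0\in\mathbb R$, $\Delta t>0$, $I=[t_0,t_0+\Delta t]$, and let $H:I\to\mathbb C^{2^n\times2^n}$ be Hermitian-valued and $C^\infty$ (one-sided derivatives at the endpoints). Let $\Lambda:I\to[0,\infty)$ satisfy $\Lambda(t)\ge\|H^{(j)}(t)\|^{1/(j+1)}$ for all $t\in I$ and all $j\ge 0$, and suppose that $\Lambda$ attains its maximum on $I$ (for example, $\Lambda$ continuous) and that this maximum is positive. Let $U(t,t_0)$ be the solution on $I$ of $i\,\partial_tU(t,t_0)=H(t)U(t,t_0)$, $U(t_0,t_0)=1$. Then $$\big\|U(t_0+\Delta t,t_0)-U_{k}(t_0+\Delta t,t_0)\big\|<0.32\,\|a\|_1\Big(41\max_{\tau\in I}\Lambda(\tau)\,\Delta t\Big)^{2M+1}.$$ -/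

import Mathlib

open Filter Asymptotics
open scoped ContDiff Matrix.Norms.L2Operator

/-- `Λ` bounds the Hamiltonian on the set `I`: for every `t ∈ I` and every order `j`,
`‖H^{(j)}(t)‖^{1/(j+1)} ≤ Λ t`, in the spectral norm. At the endpoints of an interval the
derivatives are one-sided. -/
def IsLambdaBound {ι : Type*} [Fintype ι] [DecidableEq ι]
    (H : ℝ → Matrix ι ι ℂ) (I : Set ℝ) (Λ : ℝ → ℝ) : Prop :=
  ∀ t ∈ I, ∀ j : ℕ, ‖iteratedDerivWithin j H I t‖ ^ ((1 : ℝ) / ((j : ℝ) + 1)) ≤ Λ t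

/-- `U` is the propagator `t ↦ U(t, t₀)` of `H` on `[t₀, t₁]`: it solves
`i ∂ₜ U = H U`, `U(t₀, t₀) = 1`. -/
def IsPropagator {ι : Type*} [Fintype ι] [DecidableEq ι]
    (H : ℝ → Matrix ι ι ℂ) (t₀ t₁ : ℝ) (U : ℝ → Matrix ι ι ℂ) : Prop :=
  U t₀ = 1 ∧ ∀ t ∈ Set.Icc t₀ t₁,
    HasDerivWithinAt U (-Complex.I • (H t * U t)) (Set.Icc t₀ t₁) t

/-- The midpoint formula `U₂(s + δ, s) = exp(-i H(s + δ/2) δ)`. -/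
noncomputable def midpointFormula {ι : Type*} [Fintype ι] [DecidableEq ι]
    (H : ℝ → Matrix ι ι ℂ) (t s : ℝ) : Matrix ι ι ℂ :=
  NormedSpace.exp ((-Complex.I * ((t - s : ℝ) : ℂ)) • H (s + (t - s) / 2))

/-- The ordered product `f (k - 1) * ⋯ * f 1 * f 0`, in which later factors stand on the left. -/
def orderedProd {A : Type*} [Monoid A] (f : ℕ → A) : ℕ → A
  | 0 => 1
  | k + 1 => f k * orderedProd f k

/-- `U₂^{(k)}(t₀ + Δt, t₀)`: the midpoint formula applied on each of `k` equal steps. The factor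
with index `q = 0, …, k - 1` is `U₂(t₀ + Δt (q + 1) / k, t₀ + Δt q / k)`. -/
noncomputable def midpointSteps {ι : Type*} [Fintype ι] [DecidableEq ι]
    (H : ℝ → Matrix ι ι ℂ) (k : ℕ) (t₀ Δt : ℝ) : Matrix ι ι ℂ :=
  orderedProd (fun q : ℕ =>
    midpointFormula H (t₀ + Δt * ((q : ℝ) + 1) / (k : ℝ)) (t₀ + Δt * (q : ℝ) / (k : ℝ))) k

/-- The midpoint-based multiproduct formula
`U_k(t₀ + Δt, t₀) = ∑ⱼ aⱼ U₂^{(kⱼ)}(t₀ + Δt, t₀)`. -/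
noncomputable def multiproductFormula {ι : Type*} [Fintype ι] [DecidableEq ι] {M : ℕ}
    (H : ℝ → Matrix ι ι ℂ) (k : Fin M → ℕ) (a : Fin M → ℝ) (t₀ Δt : ℝ) : Matrix ι ι ℂ :=
  ∑ j, (a j : ℂ) • midpointSteps H (k j) t₀ Δt

/-- The Vandermonde system of a multiproduct formula of order `2M`:
`∑ⱼ aⱼ = 1` and `∑ⱼ aⱼ kⱼ^{-2l} = 0` for `l = 1, …, M - 1`. -/
def SatisfiesVandermonde {M : ℕ} (k : Fin M → ℕ) (a : Fin M → ℝ) : Prop :=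
  ∀ l : ℕ, l < M → ∑ j, a j * (((k j : ℝ) ^ (2 * l))⁻¹) = if l = 0 then 1 else 0

/-! Order conditions. Write -iH(t₀ + s) = ∑ B_p s^p. The h^j-coefficient of N consecutive midpoint
steps of length h is a polynomial in N of degree at most j, whose coefficient of N^j is the j-th
Taylor coefficient of the propagator (`coeff_stepsPoly`). This polynomial makes sense for negative
N, and the time symmetry of the midpoint rule says that changing the signs of both N and h changes
nothing (`dilate_neg_one_stepsSeries_neg`). Hence only powers N^n with n ≡ j mod 2 occur. For N = k
and h = s/k the unwanted terms carry factors k^(-2l) with l ≥ 1. The polynomial vanishes at N = 0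
when j > 0, so l ≤ M - 1 for all j ≤ 2M, and the Vandermonde equations remove these terms
(`sum_smul_coeff_stepsSeries`).

Remainder. Let Λ be the maximum of the bound. In the weighted ℓ¹ norm of radius 1/(2Λ) the
propagator series has norm at most 2 and every k-step series at most 3, uniformly in k. Their
combination vanishes through order 2M, so its value is at most (2ΛΔt)^(2M+1) (2 + 3‖a‖₁) when ΛΔt <
1/2 (`norm_sub_multiproductFormula_le`). For longer intervals unitarity gives the bound 1 + ‖a‖₁.
Both fit under the stated bound because ‖a‖₁ ≥ 1.

Conditioning. The weights are Lagrange basis polynomials at 0 for the nodes k_j⁻², with k_j close to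
48M²/(2j+1). For exact ratios, |a_j| is 1/(2j+1) times a bounded Wallis product times a ratio of
factorials of size at most exp(-j(j+1)/M). This Gaussian gain pays for rounding k_j to integers, so
|a_j| ≤ 3/(2j+1) (`abs_stepWeight_le`), and a harmonic sum gives log M. -/

/-! ### A well-conditioned family of nodes -/

section Nodes

open Finset

/-- The product of the node distances for the nodes `(2l+1)²`. -/
theorem prod_abs_odd_sq_sub (j m : ℕ) :
    (∏ l ∈ (range (j + 1 + m)).erase j, |(2 * l + 1 : ℝ) ^ 2 - (2 * j + 1) ^ 2|) * (2 * j + 1) =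
      4 ^ (j + m) * (m.factorial : ℝ) * ((j + 1 + m + j).factorial : ℝ) := by
  induction m with
  | zero =>
    have h1 : (range (j + 1 + 0)).erase j = range j := by
      ext x; simp; omega
    have h2 : ∀ l ∈ range j, |(2 * l + 1 : ℝ) ^ 2 - (2 * j + 1) ^ 2| =
        4 * (((j - 1 - l : ℕ) : ℝ) + 1) * ((j + 1 + l : ℕ) : ℝ) := by
      intro l hl
      have hl' : l + 1 ≤ j := mem_range.1 hl
      obtain ⟨i, rfl⟩ := Nat.exists_eq_add_of_le hl'
      have : l + 1 + i - 1 - l = i := by omega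
      rw [this, abs_of_nonpos]
      · push_cast; ring
      · push_cast
        nlinarith [(Nat.cast_nonneg l : (0 : ℝ) ≤ l), (Nat.cast_nonneg i : (0 : ℝ) ≤ i)]
    have h3 : ∏ l ∈ range j, (((j - 1 - l : ℕ) : ℝ) + 1) = (j.factorial : ℝ) := by
      rw [prod_range_reflect (fun l : ℕ => (l : ℝ) + 1) j, ← prod_range_add_one_eq_factorial]
      push_cast; rfl
    have h4 : (j.factorial : ℝ) * ∏ l ∈ range j, ((j + 1 + l : ℕ) : ℝ) =
        ((j + j).factorial : ℝ) := by
      rw [← Nat.factorial_mul_ascFactorial, Nat.ascFactorial_eq_prod_range]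
      push_cast; rfl
    rw [h1, prod_congr rfl h2, prod_mul_distrib, prod_mul_distrib, h3, prod_const, card_range]
    have h5 : j + 1 + 0 + j = (j + j) + 1 := by omega
    rw [h5, Nat.factorial_succ, Nat.cast_mul, ← h4]
    push_cast [Nat.factorial]
    ring
  | succ m ih =>
    have h1 : (range (j + 1 + (m + 1))).erase j = insert (j + 1 + m) ((range (j + 1 + m)).erase j) := by
      ext x; simp; omega
    rw [h1, prod_insert (by simp), mul_assoc, ih, abs_of_nonneg]
    · have h5 : j + 1 + (m + 1) + j = (j + 1 + m + j) + 1 := by omega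
      rw [h5, Nat.factorial_succ, Nat.factorial_succ]
      push_cast
      ring
    · push_cast
      nlinarith [(Nat.cast_nonneg j : (0 : ℝ) ≤ j), (Nat.cast_nonneg m : (0 : ℝ) ≤ m)]

/-- Supplies the Gaussian decay of the weights in j. With N = j + m + 1 fixed, raising j to j + 1
costs a factor (1 - y)/(1 + y) ≤ exp(-2y), where y = (j + 1)/N, and these exponents add up to j(j +
1)/N. -/
theorem factorial_mul_factorial_ge (j m : ℕ) :
    ((j + m).factorial : ℝ) * ((j + 1 + m).factorial : ℝ) *
        Real.exp (j * (j + 1) / (j + 1 + m)) ≤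
      (m.factorial : ℝ) * ((j + 1 + m + j).factorial : ℝ) := by
  suffices H : ∀ i m N : ℕ, N = m + i + 1 →
      ((N - 1).factorial : ℝ) * (N.factorial : ℝ) * Real.exp (i * (i + 1) / N) ≤
      (m.factorial : ℝ) * ((N + i).factorial : ℝ) by
    have := H j m (j + 1 + m) (by omega)
    have e : j + 1 + m - 1 = j + m := by omega
    rw [e] at this
    exact_mod_cast this
  intro i
  induction i with
  | zero =>
    rintro m N rfl
    simp
  | succ i ih =>
    intro m N hN
    have h := ih (m + 1) N (by omega)
    have hNp : (0 : ℝ) < N := by rw [hN]; positivity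
    have hexp : Real.exp ((i + 1 : ℕ) * ((i + 1 : ℕ) + 1) / N) =
        Real.exp (i * (i + 1) / N) * (Real.exp (-(2 * (i + 1) / N)))⁻¹ := by
      rw [← Real.exp_neg, ← Real.exp_add]; congr 1; push_cast; field_simp; ring
    have hr : ((m : ℝ) + 1) ≤ (N + i + 1) * Real.exp (-(2 * (i + 1) / N)) := by
      set y : ℝ := (i + 1) / N with hy
      have hy0 : 0 ≤ y := by positivity
      have hiN : (i : ℝ) + 1 = y * N := by rw [hy]; field_simp
      have hm : (m : ℝ) + 1 = (1 - y) * N := by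
        have : (N : ℝ) = m + (i + 1) + 1 := by rw [hN]; push_cast; ring
        linear_combination -hiN - this
      have e1 : 2 * ((i : ℝ) + 1) / N = 2 * y := by rw [hy]; ring
      have hy1 : y < 1 := by
        have : 0 < (1 - y) * N := by rw [← hm]; positivity
        nlinarith
      -- This is log((1 + y)/(1 - y)) ≥ 2y, obtained from log(1 + x) ≥ 2x/(x + 2) at x = 2y/(1 - y).
      have key : 1 - y ≤ (1 + y) * Real.exp (-(2 * y)) := by
        have h1 := Real.le_log_one_add_of_nonneg (x := 2 * y / (1 - y))
          (div_nonneg (by linarith) (by linarith))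
        have hy2 : 0 < 1 - y := by linarith
        have h2 : 2 * (2 * y / (1 - y)) / (2 * y / (1 - y) + 2) = 2 * y := by field_simp; ring
        have h3 : 1 + 2 * y / (1 - y) = (1 + y) / (1 - y) := by field_simp; ring
        rw [h2, h3, Real.le_log_iff_exp_le (by positivity), le_div_iff₀ hy2] at h1
        rw [Real.exp_neg, ← div_eq_mul_inv, le_div_iff₀ (Real.exp_pos _)]
        linarith
      rw [e1, hm, add_assoc, hiN]
      nlinarith
    have hpos : 0 < Real.exp (-(2 * ((i : ℝ) + 1) / N)) := Real.exp_pos _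
    rw [hexp, ← mul_assoc, ← div_eq_mul_inv, div_le_iff₀ hpos]
    refine h.trans ?_
    rw [Nat.factorial_succ, ← add_assoc, Nat.factorial_succ]
    push_cast
    have : (0 : ℝ) ≤ (m.factorial : ℝ) * ((N + i).factorial : ℝ) := by positivity
    nlinarith [mul_le_mul_of_nonneg_left hr this]

theorem prod_odd_sq_le (M : ℕ) :
    (∏ l ∈ range (M + 1), (2 * l + 1 : ℝ) ^ 2) ≤
      2 * (4 ^ M * (M.factorial : ℝ) * ((M + 1).factorial : ℝ)) := by
  -- A constant factor 2 does not pass through the induction, since each step multiplies the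
  -- quotient by slightly more than 1; the deficit 1/(M + 1) absorbs this growth.
  suffices H : (∏ l ∈ range (M + 1), (2 * l + 1 : ℝ) ^ 2) ≤
      (2 - 1 / (M + 1)) * (4 ^ M * (M.factorial : ℝ) * ((M + 1).factorial : ℝ)) by
    refine H.trans ?_
    gcongr
    have : (0 : ℝ) < 1 / (M + 1) := by positivity
    linarith
  induction M with
  | zero => norm_num
  | succ M ih =>
    rw [prod_range_succ]
    refine (mul_le_mul_of_nonneg_right ih (by positivity)).trans ?_
    rw [Nat.factorial_succ (M + 1), Nat.factorial_succ M]
    have hF : (0 : ℝ) < 4 ^ M * (M.factorial : ℝ) * ((M.factorial : ℝ)) := by positivity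
    have key : (2 - 1 / ((M : ℝ) + 1)) * (2 * (M + 1) + 1) ^ 2 ≤
        (2 - 1 / ((M : ℝ) + 1 + 1)) * (4 * (M + 1) * (M + 1 + 1)) := by
      have h0 : (0 : ℝ) ≤ M := Nat.cast_nonneg M
      have e1 : (2 - 1 / ((M : ℝ) + 1)) = (2 * M + 1) / (M + 1) := by field_simp; ring
      have e2 : (2 - 1 / ((M : ℝ) + 1 + 1)) * (4 * (M + 1) * (M + 1 + 1)) = (2 * M + 3) * 4 * (M + 1) := by
        field_simp; ring
      rw [e1, e2, div_mul_eq_mul_div, div_le_iff₀ (by positivity)]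
      nlinarith
    have := mul_le_mul_of_nonneg_right key (mul_nonneg hF.le (by positivity : (0 : ℝ) ≤ (M : ℝ) + 1))
    push_cast
    refine le_trans (le_of_eq ?_) (this.trans (le_of_eq ?_)) <;> ring

/-- Cost of rounding in one Lagrange factor. If k were exactly L/τ, the factor k_j²/|k_l² - k_j²|
would equal τ_l²/|τ_l² - τ_j²|. The remainders r perturb the difference τ_l² - τ_j² by a relative
error of at most 3τ_j²/L. -/
theorem node_factor_le {L τj τl rj rl kj kl : ℝ} (hτj : 1 ≤ τj) (hτl : 1 ≤ τl)
    (hτ : 2 ≤ |τl - τj|) (hL : 12 * τj ^ 2 ≤ L)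
    (hrj : 0 ≤ rj) (hrj' : rj ≤ τj) (hrl : 0 ≤ rl) (hrl' : rl ≤ τl)
    (hkj : kj * τj = L - rj) (hkl : kl * τl = L - rl) (hkl0 : 0 ≤ kl) :
    kj ^ 2 * |τl ^ 2 - τj ^ 2| ≤ τl ^ 2 * Real.exp (6 * τj ^ 2 / L) * |kl ^ 2 - kj ^ 2| := by
  have hL0 : 0 < L := by nlinarith
  have hj0 : 0 < L - rj := by nlinarith
  have hsum : 0 < τl + τj := by linarith
  set g : ℝ := (L - rl) / (L - rj) with hg
  have hg0 : 0 ≤ g := by rw [hg, ← hkl]; positivity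
  have hg2 : g ≤ 2 := by
    rw [hg, div_le_iff₀ hj0]; nlinarith
  have hg1 : |1 - g| ≤ 2 * (τl + τj) / L := by
    have : 1 - g = (rl - rj) / (L - rj) := by rw [hg]; field_simp; ring
    rw [this, abs_div, abs_of_pos hj0, div_le_div_iff₀ hj0 hL0]
    have h1 : |rl - rj| ≤ τl + τj := abs_le.2 ⟨by linarith, by linarith⟩
    have h2 : L ≤ 2 * (L - rj) := by nlinarith
    nlinarith
  have hgg : |1 - g ^ 2| ≤ 6 * (τl + τj) / L := by
    have : 1 - g ^ 2 = (1 - g) * (1 + g) := by ring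
    rw [this, abs_mul, abs_of_nonneg (by linarith : 0 ≤ 1 + g)]
    calc |1 - g| * (1 + g) ≤ (2 * (τl + τj) / L) * 3 := by gcongr; linarith
      _ = _ := by ring
  have hD : |τl ^ 2 - τj ^ 2| = |τl - τj| * (τl + τj) := by
    rw [show τl ^ 2 - τj ^ 2 = (τl - τj) * (τl + τj) by ring, abs_mul, abs_of_pos hsum]
  have hklg : τl ^ 2 * kl ^ 2 = τj ^ 2 * kj ^ 2 * g ^ 2 := by
    have : kl * τl = kj * τj * g := by rw [hkl, hkj, hg]; field_simp
    calc τl ^ 2 * kl ^ 2 = (kl * τl) ^ 2 := by ring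
      _ = _ := by rw [this]; ring
  have hmain : τl ^ 2 * |kl ^ 2 - kj ^ 2| = kj ^ 2 * |(τl ^ 2 - τj ^ 2) + τj ^ 2 * (1 - g ^ 2)| := by
    rw [← abs_of_nonneg (sq_nonneg τl), ← abs_mul, abs_of_nonneg (sq_nonneg τl),
      ← abs_of_nonneg (sq_nonneg kj), ← abs_mul, abs_of_nonneg (sq_nonneg kj), ← abs_neg]
    congr 1; linear_combination -hklg
  set u : ℝ := 3 * τj ^ 2 / L with hu
  have hu0 : 0 ≤ u := by positivity
  have hu1 : u ≤ 1 / 4 := by rw [hu, div_le_iff₀ hL0]; linarith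
  -- The perturbation is proportional to τ_l + τ_j, which is also a factor of τ_l² - τ_j²; the gap
  -- |τ_l - τ_j| ≥ 2 turns it into a relative error.
  have hlow : |τl ^ 2 - τj ^ 2| * (1 - u) ≤ |(τl ^ 2 - τj ^ 2) + τj ^ 2 * (1 - g ^ 2)| := by
    have h1 := abs_sub_abs_le_abs_sub (τl ^ 2 - τj ^ 2) (-(τj ^ 2 * (1 - g ^ 2)))
    rw [sub_neg_eq_add, abs_neg, abs_mul, abs_of_nonneg (sq_nonneg τj)] at h1
    refine le_trans ?_ h1
    have h2 : τj ^ 2 * |1 - g ^ 2| ≤ |τl ^ 2 - τj ^ 2| * u := by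
      rw [hD]
      calc τj ^ 2 * |1 - g ^ 2| ≤ τj ^ 2 * (6 * (τl + τj) / L) := by gcongr
        _ = 2 * (τl + τj) * u := by rw [hu]; ring
        _ ≤ |τl - τj| * (τl + τj) * u := by gcongr
    linarith
  have hexp : 1 ≤ Real.exp (6 * τj ^ 2 / L) * (1 - u) := by
    have h1 := Real.add_one_le_exp (6 * τj ^ 2 / L)
    have h2 : 6 * τj ^ 2 / L = 2 * u := by rw [hu]; ring
    rw [h2] at h1 ⊢
    nlinarith
  calc kj ^ 2 * |τl ^ 2 - τj ^ 2| = kj ^ 2 * |τl ^ 2 - τj ^ 2| * 1 := by ring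
    _ ≤ kj ^ 2 * |τl ^ 2 - τj ^ 2| * (Real.exp (6 * τj ^ 2 / L) * (1 - u)) := by gcongr
    _ = Real.exp (6 * τj ^ 2 / L) * (kj ^ 2 * (|τl ^ 2 - τj ^ 2| * (1 - u))) := by ring
    _ ≤ Real.exp (6 * τj ^ 2 / L) * (kj ^ 2 * |(τl ^ 2 - τj ^ 2) + τj ^ 2 * (1 - g ^ 2)|) := by
        gcongr
    _ = _ := by rw [← hmain]; ring

/-- The step numbers `⌊48 M² / (2j + 1)⌋`. -/
def stepNumber (M : ℕ) (j : Fin M) : ℕ := 48 * M ^ 2 / (2 * j + 1)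

/-- The weights extrapolating polynomials of degree `< M` from the points `k_j⁻²` to `0`. -/
noncomputable def stepWeight (M : ℕ) (j : Fin M) : ℝ :=
  (Lagrange.basis univ (fun i : Fin M => ((stepNumber M i : ℝ) ^ 2)⁻¹) j).eval 0

theorem stepNumber_le (M : ℕ) (j : Fin M) : stepNumber M j ≤ 48 * M ^ 2 := Nat.div_le_self _ _

theorem stepNumber_pos (M : ℕ) (j : Fin M) : 0 < stepNumber M j := by
  have := j.2
  exact Nat.div_pos (by nlinarith) (by omega)

/-- The constant 48 enters here: 2j + 1 ≤ 2M gives 12(2j + 1)² ≤ 48M², as `node_factor_le` requires.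
-/
theorem stepNumber_factor_le {M : ℕ} {j l : Fin M} (h : l ≠ j) :
    (stepNumber M j : ℝ) ^ 2 * |(2 * l + 1 : ℝ) ^ 2 - (2 * j + 1) ^ 2| ≤
      (2 * l + 1 : ℝ) ^ 2 * Real.exp ((2 * j + 1) ^ 2 / (8 * M ^ 2)) *
        |(stepNumber M l : ℝ) ^ 2 - (stepNumber M j : ℝ) ^ 2| := by
  have hM : (0 : ℝ) < M := by have := j.2; exact_mod_cast (by omega : 0 < M)
  have hjM : (j : ℝ) + 1 ≤ M := by exact_mod_cast j.2
  have hr : ∀ i : Fin M, (stepNumber M i : ℝ) * (2 * i + 1) =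
      48 * M ^ 2 - ((48 * M ^ 2 % (2 * (i : ℕ) + 1) : ℕ) : ℝ) := by
    intro i
    have h1 : (stepNumber M i : ℕ) * (2 * i + 1) + 48 * M ^ 2 % (2 * (i : ℕ) + 1) = 48 * M ^ 2 :=
      Nat.div_add_mod' _ _
    rw [eq_sub_iff_add_eq]
    exact_mod_cast h1
  have hr' : ∀ i : Fin M, ((48 * M ^ 2 % (2 * (i : ℕ) + 1) : ℕ) : ℝ) ≤ 2 * i + 1 := by
    intro i
    exact_mod_cast (Nat.mod_lt _ (by omega : 0 < 2 * (i : ℕ) + 1)).le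
  have key := node_factor_le (L := 48 * M ^ 2) (τj := 2 * j + 1) (τl := 2 * l + 1)
    (by linarith [(Nat.cast_nonneg (j : ℕ) : (0 : ℝ) ≤ (j : ℕ))])
    (by linarith [(Nat.cast_nonneg (l : ℕ) : (0 : ℝ) ≤ (l : ℕ))])
    (by
      have h1 : (1 : ℤ) ≤ |(l : ℤ) - j| := Int.one_le_abs (by
        intro h2; exact h (Fin.ext (by omega)))
      have h2 : (1 : ℝ) ≤ |(l : ℝ) - j| := by exact_mod_cast h1
      rw [show (2 * (l : ℝ) + 1 - (2 * j + 1)) = 2 * (l - j) by ring, abs_mul, abs_two]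
      linarith)
    (by nlinarith [(Nat.cast_nonneg (j : ℕ) : (0 : ℝ) ≤ (j : ℕ))])
    (Nat.cast_nonneg _) (hr' j) (Nat.cast_nonneg _) (hr' l) (hr j) (hr l) (Nat.cast_nonneg _)
  have e : (2 * (j : ℝ) + 1) ^ 2 / (8 * M ^ 2) = 6 * (2 * (j : ℝ) + 1) ^ 2 / (48 * M ^ 2) := by
    field_simp; norm_num
  rw [e]
  exact key

/-- Rounding cannot merge two nodes: the right side of `stepNumber_factor_le` would then be zero and
the left side positive. -/
theorem stepNumber_sq_inv_injective (M : ℕ) :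
    Function.Injective (fun i : Fin M => ((stepNumber M i : ℝ) ^ 2)⁻¹) := by
  intro l j hlj
  by_contra h
  have hk : (stepNumber M l : ℝ) ^ 2 = (stepNumber M j : ℝ) ^ 2 := inv_injective hlj
  have key := stepNumber_factor_le h
  rw [hk, sub_self, abs_zero, mul_zero] at key
  have h0 : (0 : ℝ) < (stepNumber M j : ℝ) ^ 2 := by have := stepNumber_pos M j; positivity
  have h1 : (2 * l + 1 : ℝ) ^ 2 - (2 * j + 1) ^ 2 ≠ 0 := by
    intro h2
    have h3 : ((l : ℝ) - j) * (l + j + 1) = 0 := by linarith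
    rcases mul_eq_zero.1 h3 with h4 | h4
    · exact h (Fin.ext (by exact_mod_cast sub_eq_zero.1 h4))
    · have : (0 : ℝ) < (l : ℝ) + j + 1 := by positivity
      linarith
  have := mul_pos h0 (abs_pos.2 h1)
  linarith

/-- Interpolation at M nodes reproduces X^l for l < M; evaluating at 0 gives the equations. -/
theorem satisfiesVandermonde_stepWeight (M : ℕ) :
    SatisfiesVandermonde (stepNumber M) (stepWeight M) := by
  intro l hl
  have h := Lagrange.eq_interpolate_of_eval_eq (s := univ) (f := (Polynomial.X : Polynomial ℝ) ^ l)
    (r := fun j : Fin M => (((stepNumber M j : ℝ) ^ 2)⁻¹) ^ l)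
    (stepNumber_sq_inv_injective M).injOn (by simpa using hl) (by simp)
  have h2 := congrArg (Polynomial.eval 0) h
  rw [Lagrange.interpolate_apply, Polynomial.eval_finsetSum] at h2
  simp only [Polynomial.eval_pow, Polynomial.eval_X, Polynomial.eval_mul, Polynomial.eval_C] at h2
  rw [zero_pow_eq] at h2
  rw [h2]
  refine sum_congr rfl fun j _ => ?_
  rw [stepWeight, mul_comm, pow_mul, inv_pow]

/-- The factor 3 is 2 from the Wallis product times 3/2 ≥ exp(1/8), the part of the rounding loss
that the factorial ratio does not absorb. -/
theorem abs_stepWeight_le (M : ℕ) (j : Fin M) : |stepWeight M j| ≤ 3 / (2 * j + 1) := by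
  have hM : (0 : ℝ) < M := by have := j.2; exact_mod_cast (by omega : 0 < M)
  obtain ⟨m, hm⟩ := Nat.exists_eq_add_of_le (show (j : ℕ) + 1 ≤ M from j.2)
  set E : ℝ := Real.exp ((2 * j + 1) ^ 2 / (8 * M ^ 2)) with hE
  have hprod : |stepWeight M j| = ∏ l ∈ univ.erase j,
      ((stepNumber M j : ℝ) ^ 2 / |(stepNumber M l : ℝ) ^ 2 - (stepNumber M j : ℝ) ^ 2|) := by
    rw [stepWeight, Lagrange.basis, Polynomial.eval_prod, abs_prod]
    refine prod_congr rfl fun l hl => ?_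
    have h1 : (0 : ℝ) < (stepNumber M l : ℝ) ^ 2 := by have := stepNumber_pos M l; positivity
    have h2 : (0 : ℝ) < (stepNumber M j : ℝ) ^ 2 := by have := stepNumber_pos M j; positivity
    rw [Lagrange.basisDivisor, Polynomial.eval_mul, Polynomial.eval_C, Polynomial.eval_sub,
      Polynomial.eval_X, Polynomial.eval_C, zero_sub, abs_mul, abs_neg, abs_inv,
      inv_sub_inv h2.ne' h1.ne', abs_div, abs_mul, abs_of_pos h1, abs_of_pos h2, abs_inv,
      abs_of_pos h1, inv_div, div_mul_eq_mul_div, mul_inv_cancel_right₀ h1.ne']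
  have hfac : ∀ l ∈ univ.erase j,
      ((stepNumber M j : ℝ) ^ 2 / |(stepNumber M l : ℝ) ^ 2 - (stepNumber M j : ℝ) ^ 2|) ≤
        ((2 * l + 1 : ℝ) ^ 2 / |(2 * l + 1 : ℝ) ^ 2 - (2 * j + 1) ^ 2|) * E := by
    intro l hl
    have hlj : l ≠ j := (mem_erase.1 hl).1
    have h1 : 0 < |(stepNumber M l : ℝ) ^ 2 - (stepNumber M j : ℝ) ^ 2| := by
      refine abs_pos.2 fun h => hlj (stepNumber_sq_inv_injective M ?_)
      simp only [sub_eq_zero.1 h]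
    have h2 : 0 < |(2 * l + 1 : ℝ) ^ 2 - (2 * j + 1) ^ 2| := by
      refine abs_pos.2 fun h => hlj ?_
      have h3 : ((l : ℝ) - j) * (l + j + 1) = 0 := by linarith
      rcases mul_eq_zero.1 h3 with h4 | h4
      · exact Fin.ext (by exact_mod_cast sub_eq_zero.1 h4)
      · have : (0 : ℝ) < (l : ℝ) + j + 1 := by positivity
        linarith
    rw [div_mul_eq_mul_div, div_le_div_iff₀ h1 h2]
    exact stepNumber_factor_le hlj
  rw [hprod]
  refine (prod_le_prod (fun l _ => by positivity) hfac).trans ?_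
  rw [prod_mul_distrib, prod_const, card_erase_of_mem (mem_univ _), card_univ, Fintype.card_fin,
    prod_div_distrib]
  -- Since (2j + 1)² = 4j(j + 1) + 1, the total rounding loss has exponent at most j(j + 1)/(2M) +
  -- 1/(8M), within the gain from `factorial_mul_factorial_ge` up to exp(1/8).
  have hEp : E ^ (M - 1) ≤ Real.exp (1 / 8) * Real.exp ((j : ℝ) * (j + 1) / M) := by
    rw [hE, ← Real.exp_nat_mul, ← Real.exp_add]
    apply Real.exp_le_exp.2
    have h1 : ((M - 1 : ℕ) : ℝ) ≤ M := by exact_mod_cast Nat.sub_le _ _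
    have hM1 : (1 : ℝ) ≤ M := by have := j.2; exact_mod_cast (by omega : 1 ≤ M)
    calc ((M - 1 : ℕ) : ℝ) * ((2 * (j : ℝ) + 1) ^ 2 / (8 * (M : ℝ) ^ 2))
        ≤ (M : ℝ) * ((2 * (j : ℝ) + 1) ^ 2 / (8 * (M : ℝ) ^ 2)) := by gcongr
      _ = 1 / 8 * (1 / (M : ℝ)) + ((j : ℝ) * (j + 1) / M) / 2 := by field_simp; ring
      _ ≤ 1 / 8 * 1 + ((j : ℝ) * (j + 1) / M) := by
        have h2 : 1 / (M : ℝ) ≤ 1 := (div_le_one hM).2 hM1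
        have h3 : 0 ≤ (j : ℝ) * (j + 1) / M := by positivity
        linarith
      _ = _ := by ring
  have hnum : ∏ l ∈ univ.erase j, (2 * (l : ℝ) + 1) ^ 2 =
      (∏ l ∈ range M, (2 * (l : ℝ) + 1) ^ 2) / (2 * (j : ℝ) + 1) ^ 2 := by
    rw [eq_div_iff (by positivity), prod_erase_mul _ _ (mem_univ j),
      ← Fin.prod_univ_eq_prod_range (fun l : ℕ => (2 * (l : ℝ) + 1) ^ 2)]
  have hden : ∏ l ∈ univ.erase j, |(2 * (l : ℝ) + 1) ^ 2 - (2 * j + 1) ^ 2| =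
      ∏ l ∈ (range M).erase j, |(2 * (l : ℝ) + 1) ^ 2 - (2 * j + 1) ^ 2| := by
    refine prod_bij (fun l _ => (l : ℕ)) ?_ ?_ ?_ ?_
    · intro l hl
      simp only [mem_erase, mem_univ, and_true, mem_range] at hl ⊢
      exact ⟨fun h => hl (Fin.ext h), l.2⟩
    · intro a _ b _ hab; exact Fin.ext hab
    · intro b hb
      simp only [mem_erase, mem_range] at hb
      exact ⟨⟨b, hb.2⟩, by simp [Fin.ext_iff, hb.1], rfl⟩
    · intro l _; rfl
  have hden2 := prod_abs_odd_sq_sub j m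
  rw [← hm, ← hden] at hden2
  have hnum2 := prod_odd_sq_le (j + m)
  rw [show (j : ℕ) + m + 1 = M by omega] at hnum2
  have hfact := factorial_mul_factorial_ge j m
  rw [← hm, show (j : ℝ) + 1 + m = M by exact_mod_cast hm.symm] at hfact
  rw [hnum]
  set D := ∏ l ∈ univ.erase j, |(2 * (l : ℝ) + 1) ^ 2 - (2 * j + 1) ^ 2|
  have hτ : (0 : ℝ) < 2 * (j : ℝ) + 1 := by positivity
  have hDpos : 0 < D * (2 * (j : ℝ) + 1) := by rw [hden2]; positivity
  have hexp : Real.exp (1 / 8) ≤ 3 / 2 := by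
    have h1 := Real.exp_bound_div_one_sub_of_interval (x := 1 / 8) (by norm_num) (by norm_num)
    refine h1.trans (by norm_num)
  have hD0 : 0 < D := pos_of_mul_pos_left hDpos hτ.le
  have e1 : (∏ l ∈ range M, (2 * (l : ℝ) + 1) ^ 2) / (2 * (j : ℝ) + 1) ^ 2 / D * E ^ (M - 1) =
      ((∏ l ∈ range M, (2 * (l : ℝ) + 1) ^ 2) * E ^ (M - 1)) / (D * (2 * (j : ℝ) + 1)) / (2 * (j : ℝ) + 1) := by
    field_simp
  rw [e1]
  gcongr
  rw [div_le_iff₀ hDpos, hden2]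
  set F : ℝ := ((j + m : ℕ).factorial : ℝ) * (M.factorial : ℝ)
  calc (∏ l ∈ range M, (2 * (l : ℝ) + 1) ^ 2) * E ^ (M - 1)
      ≤ (2 * (4 ^ (j + m : ℕ) * ((j + m : ℕ).factorial : ℝ) * (M.factorial : ℝ))) *
        (3 / 2 * Real.exp ((j : ℝ) * (j + 1) / M)) := by
        refine mul_le_mul hnum2 (hEp.trans ?_) (by positivity) (by positivity)
        gcongr
    _ = 3 * (4 ^ (j + m : ℕ) * (((j + m : ℕ).factorial : ℝ) * (M.factorial : ℝ) *
        Real.exp ((j : ℝ) * (j + 1) / M))) := by ring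
    _ ≤ 3 * (4 ^ (j + m : ℕ) * ((m.factorial : ℝ) * ((M + j).factorial : ℝ))) := by gcongr
    _ = _ := by ring

theorem sum_abs_stepWeight_le (M : ℕ) : ∑ j, |stepWeight M j| ≤ 3 * (1 + Real.log M) := by
  calc ∑ j, |stepWeight M j| ≤ ∑ j : Fin M, 3 * ((j : ℝ) + 1)⁻¹ := by
        refine sum_le_sum fun j _ => (abs_stepWeight_le M j).trans ?_
        rw [← div_eq_mul_inv]
        gcongr
        linarith [(Nat.cast_nonneg (j : ℕ) : (0 : ℝ) ≤ (j : ℕ))]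
    _ = 3 * ((harmonic M : ℚ) : ℝ) := by
        rw [← mul_sum, Fin.sum_univ_eq_sum_range (fun j : ℕ => ((j : ℝ) + 1)⁻¹), harmonic]
        push_cast; rfl
    _ ≤ 3 * (1 + Real.log M) := by gcongr; exact harmonic_le_one_add_log M

theorem sum_abs_stepWeight_isBigO :
    (fun M : ℕ => ∑ j, |stepWeight M j|) =O[atTop] fun M : ℕ => Real.log (M : ℝ) := by
  refine IsBigO.of_bound 6 ?_
  filter_upwards [eventually_ge_atTop 3] with M hM
  have h1 : 1 ≤ Real.log M := by
    rw [Real.le_log_iff_exp_le (by positivity)]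
    have : (3 : ℝ) ≤ M := by exact_mod_cast hM
    linarith [Real.exp_one_lt_d9]
  rw [Real.norm_of_nonneg (by positivity), Real.norm_of_nonneg (by positivity)]
  linarith [sum_abs_stepWeight_le M]

theorem sup_stepNumber_isBigO :
    (fun M : ℕ => ((univ.sup (stepNumber M) : ℕ) : ℝ)) =O[atTop] fun M : ℕ => (M : ℝ) ^ 2 := by
  refine IsBigO.of_bound 48 (Eventually.of_forall fun M => ?_)
  rw [Real.norm_of_nonneg (by positivity), Real.norm_of_nonneg (by positivity)]
  exact_mod_cast Finset.sup_le fun j _ => stepNumber_le M j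

end Nodes

/-! ### Formal expansion of the composed midpoint rule -/

section Formal

open Finset

variable {R : Type*} [Ring R] [Algebra ℝ R]

/-! ### Discrete antiderivatives of polynomials with noncommuting coefficients. -/

namespace Polynomial

/-- Evaluation of a polynomial over an `ℝ`-algebra at a real point. -/
noncomputable def realEval (x : ℝ) (P : R[X]) : R := P.eval (algebraMap ℝ R x)

theorem realEval_mul (x : ℝ) (P Q : R[X]) : realEval x (P * Q) = realEval x P * realEval x Q :=
  eval₂_mul_noncomm _ _ fun k => (Algebra.commutes x (Q.coeff k)).symm

theorem realEval_eq_sum (x : ℝ) {P : R[X]} {n : ℕ} (h : P.natDegree ≤ n) :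
    realEval x P = ∑ i ∈ range (n + 1), x ^ i • P.coeff i := by
  rw [realEval, eval_eq_sum_range' (Nat.lt_succ_of_le h)]
  refine sum_congr rfl fun i _ => ?_
  rw [← map_pow, ← Algebra.commutes, ← Algebra.smul_def]

/-- A polynomial `P` of degree `n + 1` with `P(x + 1) - P(x) = x ^ n` and `P(0) = 0`. -/
noncomputable def powSum (n : ℕ) : ℚ[X] := C ((n + 1 : ℚ)⁻¹) * (bernoulli (n + 1) - C (_root_.bernoulli (n + 1)))

theorem powSum_eval_add_one (n : ℕ) (x : ℚ) :
    (powSum n).eval (x + 1) = (powSum n).eval x + x ^ n := by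
  simp only [powSum, eval_mul, eval_sub, eval_C]
  rw [add_comm x 1, bernoulli_eval_one_add]
  have : (n + 1 : ℚ) ≠ 0 := by positivity
  push_cast
  field_simp
  ring

theorem powSum_comp (n : ℕ) : (powSum n).comp (X + 1) = powSum n + X ^ n := by
  refine Polynomial.funext fun x => ?_
  simp [powSum_eval_add_one]

theorem natDegree_powSum_le (n : ℕ) : (powSum n).natDegree ≤ n + 1 := by
  refine (natDegree_C_mul_le _ _).trans ((natDegree_sub_C).trans_le ?_)
  rw [natDegree_le_iff_coeff_eq_zero]
  intro N hN
  rw [coeff_bernoulli, if_neg (by omega)]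

theorem coeff_powSum (n : ℕ) : (powSum n).coeff (n + 1) = (n + 1 : ℚ)⁻¹ := by
  rw [powSum, coeff_C_mul, coeff_sub, coeff_bernoulli, coeff_C_succ]
  simp

theorem eval_powSum_zero (n : ℕ) : (powSum n).eval 0 = 0 := by
  simp [powSum]

/-- The ring homomorphism `ℚ → R` of an `ℝ`-algebra `R`. -/
noncomputable def ratHom (R : Type*) [Ring R] [Algebra ℝ R] : ℚ →+* R :=
  (algebraMap ℝ R).comp (algebraMap ℚ ℝ)

theorem realEval_map_ratHom (x : ℝ) (P : ℚ[X]) :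
    realEval x (P.map (ratHom R)) = algebraMap ℝ R ((P.map (algebraMap ℚ ℝ)).eval x) := by
  rw [realEval, ratHom, ← map_map, eval_map, eval₂_at_apply]

/-- A polynomial `Q` with `Q(x + 1) - Q(x) = P(x)` and `Q(0) = 0`. -/
noncomputable def antidiff (P : R[X]) : R[X] :=
  ∑ i ∈ range (P.natDegree + 1), C (P.coeff i) * (powSum i).map (ratHom R)

theorem realEval_antidiff_add_one (P : R[X]) (x : ℝ) :
    realEval (x + 1) (antidiff P) = realEval x (antidiff P) + realEval x P := by
  have h : ∀ i, realEval (x + 1) ((powSum i).map (ratHom R)) =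
      realEval x ((powSum i).map (ratHom R)) + algebraMap ℝ R (x ^ i) := by
    intro i
    rw [realEval_map_ratHom, realEval_map_ratHom, ← map_add]
    congr 1
    have := congrArg (fun p => (p.map (algebraMap ℚ ℝ)).eval x) (powSum_comp i)
    simpa [Polynomial.map_comp] using this
  rw [realEval_eq_sum x (P := P) le_rfl]
  simp only [antidiff]
  simp only [realEval] at h ⊢
  rw [eval_finsetSum, eval_finsetSum, ← sum_add_distrib]
  refine sum_congr rfl fun i _ => ?_
  rw [eval_C_mul, eval_C_mul, h, mul_add, ← Algebra.commutes, ← Algebra.smul_def]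

theorem realEval_zero_antidiff (P : R[X]) : realEval 0 (antidiff P) = 0 := by
  have h : ∀ i, realEval 0 ((powSum i).map (ratHom R)) = 0 := by
    intro i
    rw [realEval_map_ratHom, ← coeff_zero_eq_eval_zero, coeff_map, coeff_zero_eq_eval_zero,
      eval_powSum_zero, map_zero, map_zero]
  simp only [realEval, antidiff] at h ⊢
  rw [eval_finsetSum]
  exact sum_eq_zero fun i _ => by rw [eval_C_mul, h, mul_zero]

theorem natDegree_antidiff_le {P : R[X]} {n : ℕ} (h : P.natDegree ≤ n) :
    (antidiff P).natDegree ≤ n + 1 := by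
  refine natDegree_sum_le_of_forall_le _ _ fun i hi => ?_
  refine (natDegree_C_mul_le _ _).trans (natDegree_map_le.trans ((natDegree_powSum_le i).trans ?_))
  have := mem_range.1 hi
  omega

/-- On top coefficients summation acts like integration; this is how the continuous propagator
emerges from the discrete product. -/
theorem coeff_antidiff {P : R[X]} {n : ℕ} (h : P.natDegree ≤ n) :
    (antidiff P).coeff (n + 1) = ((n : ℝ) + 1)⁻¹ • P.coeff n := by
  have h1 : antidiff P = ∑ i ∈ range (n + 1), C (P.coeff i) * (powSum i).map (ratHom R) := by
    refine sum_subset (range_subset_range.2 (by omega)) fun i _ hi => ?_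
    rw [coeff_eq_zero_of_natDegree_lt (by simpa using hi), C_0, zero_mul]
  rw [h1, finsetSum_coeff, sum_range_succ, sum_eq_zero, zero_add, coeff_C_mul, coeff_map,
    coeff_powSum, Algebra.smul_def, Algebra.commutes]
  · simp [ratHom]
  · intro i hi
    rw [coeff_C_mul, coeff_map, coeff_eq_zero_of_natDegree_lt (p := powSum i), map_zero, mul_zero]
    have := natDegree_powSum_le i
    have := mem_range.1 hi
    omega

end Polynomial

/-! ### Rescaling and exponentials of formal power series. -/

namespace PowerSeries

/-- The substitution `X ↦ c X` in a power series over an `ℝ`-algebra. -/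
noncomputable def dilate (c : ℝ) : R⟦X⟧ →+* R⟦X⟧ where
  toFun p := mk fun n => c ^ n • coeff n p
  map_zero' := by ext; simp
  map_one' := by
    ext n
    rw [coeff_mk, coeff_one]
    split_ifs with h
    · simp [h]
    · simp
  map_add' p q := by ext; simp
  map_mul' p q := by
    ext n
    rw [coeff_mk, coeff_mul, coeff_mul, smul_sum]
    refine sum_congr rfl fun ij hij => ?_
    rw [coeff_mk, coeff_mk, smul_mul_smul_comm, ← pow_add, mem_antidiagonal.1 hij]

theorem coeff_dilate (c : ℝ) (p : R⟦X⟧) (n : ℕ) : coeff n (dilate c p) = c ^ n • coeff n p := by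
  simp [dilate]

theorem dilate_dilate (c d : ℝ) (p : R⟦X⟧) : dilate c (dilate d p) = dilate (c * d) p := by
  ext n
  rw [coeff_dilate, coeff_dilate, coeff_dilate, smul_smul, mul_pow]

theorem dilate_X (c : ℝ) : dilate c (X : R⟦X⟧) = c • X := by
  ext n
  rw [coeff_dilate, coeff_smul, coeff_X]
  split_ifs with h
  · simp [h]
  · simp

/-- The exponential of `X p`. -/
noncomputable def expXMul (p : R⟦X⟧) : R⟦X⟧ :=
  mk fun j => ∑ r ∈ range (j + 1), (r.factorial : ℝ)⁻¹ • coeff j ((X * p) ^ r)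

theorem coeff_X_mul_pow {R : Type*} [Ring R] (p : R⟦X⟧) (r j : ℕ) :
    coeff j ((X * p) ^ r) = if r ≤ j then coeff (j - r) (p ^ r) else 0 := by
  rw [(commute_X p).symm.mul_pow, coeff_X_pow_mul']

theorem coeff_expXMul (p : R⟦X⟧) {j n : ℕ} (h : j ≤ n) :
    coeff j (expXMul p) = coeff j (∑ r ∈ range (n + 1), (r.factorial : ℝ)⁻¹ • (X * p) ^ r) := by
  rw [expXMul, coeff_mk, map_sum]
  simp only [coeff_smul]
  refine sum_subset (range_subset_range.2 (by omega)) fun r _ hr => ?_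
  rw [coeff_X_mul_pow, if_neg (by simpa using hr), smul_zero]

theorem dilate_neg_one_expXMul (p : R⟦X⟧) :
    dilate (-1) (expXMul p) = expXMul (-dilate (-1) p) := by
  ext j
  rw [coeff_dilate, expXMul, expXMul, coeff_mk, coeff_mk, smul_sum]
  refine sum_congr rfl fun r _ => ?_
  rw [smul_comm, ← coeff_dilate, map_pow, map_mul, dilate_X]
  simp

theorem sum_antidiagonal_neg_one_pow_div_factorial {n : ℕ} (hn : n ≠ 0) :
    ∑ ij ∈ antidiagonal n, ((ij.1.factorial : ℝ)⁻¹ * (-1) ^ ij.1) * (ij.2.factorial : ℝ)⁻¹ = 0 := by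
  have h := congrArg (coeff n) (exp_mul_exp_neg_eq_one (A := ℝ))
  rw [mul_comm, coeff_mul, coeff_one, if_neg hn] at h
  rw [← h]
  refine sum_congr rfl fun ij _ => ?_
  simp [evalNegHom, coeff_rescale, coeff_exp, mul_comm]

theorem expXMul_neg_mul_expXMul (p : R⟦X⟧) : expXMul (-p) * expXMul p = 1 := by
  ext j
  set w : ℕ → ℕ → ℝ := fun a b => ((a.factorial : ℝ)⁻¹ * (-1) ^ a) * (b.factorial : ℝ)⁻¹ with hw
  have h1 : coeff j (expXMul (-p) * expXMul p) =
      ∑ a ∈ range (j + 1), ∑ b ∈ range (j + 1), w a b • coeff j ((X * p) ^ (a + b)) := by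
    have h2 : coeff j (expXMul (-p) * expXMul p) =
        coeff j ((∑ r ∈ range (j + 1), (r.factorial : ℝ)⁻¹ • (X * -p) ^ r) *
          (∑ r ∈ range (j + 1), (r.factorial : ℝ)⁻¹ • (X * p) ^ r)) := by
      rw [coeff_mul, coeff_mul]
      refine sum_congr rfl fun ij hij => ?_
      have := mem_antidiagonal.1 hij
      rw [coeff_expXMul _ (by omega : ij.1 ≤ j), coeff_expXMul _ (by omega : ij.2 ≤ j)]
    rw [h2, sum_mul_sum, map_sum]
    refine sum_congr rfl fun a _ => ?_
    rw [map_sum]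
    refine sum_congr rfl fun b _ => ?_
    have h3 : (X * -p) ^ a = ((-1 : ℝ) ^ a) • (X * p) ^ a := by
      rw [mul_neg, ← smul_pow, neg_one_smul]
    rw [h3, smul_smul, smul_mul_smul_comm, ← pow_add, coeff_smul]
  have h4 : ∀ a ∈ range (j + 1), ∑ b ∈ range (j + 1), w a b • coeff j ((X * p) ^ (a + b)) =
      ∑ b ∈ range (j + 1 - a), w a b • coeff j ((X * p) ^ (a + b)) := by
    intro a _
    refine (sum_subset (range_subset_range.2 (by omega)) fun b _ hb => ?_).symm
    rw [coeff_X_mul_pow, if_neg, smul_zero]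
    simp only [mem_range] at hb
    omega
  -- Grouping by total degree m = a + b leaves the scalar identity exp(-x) exp(x) = 1 in each
  -- degree; only powers of the single element X p occur, so noncommutativity plays no role.
  rw [h1, sum_congr rfl h4,
    ← sum_range_diag_flip (j + 1) (fun a b => w a b • coeff j ((X * p) ^ (a + b))),
    sum_eq_single 0]
  · simp [hw]
  · intro m _ hm
    have h5 : ∀ k ∈ range (m + 1), w k (m - k) • coeff j ((X * p) ^ (k + (m - k))) =
        w k (m - k) • coeff j ((X * p) ^ m) := by
      intro k hk
      have := mem_range.1 hk
      rw [show k + (m - k) = m by omega]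
    rw [sum_congr rfl h5, ← sum_smul, ← Nat.sum_antidiagonal_eq_sum_range_succ (fun a b => w a b),
      sum_antidiagonal_neg_one_pow_div_factorial hm, zero_smul]
  · simp

end PowerSeries

end Formal

/-! ### Time symmetry and cancellation of the low orders. -/

section FormalMidpoint

open Finset Polynomial PowerSeries

variable {R : Type*} [Ring R] [Algebra ℝ R]

/-- The expansion in `h` of `exp (h A(y h))`, where `A(s) = ∑ B_p s ^ p`. -/
noncomputable def midStepSeries (B : ℕ → R) (y : ℝ) : R⟦X⟧ :=
  expXMul (dilate y (PowerSeries.mk B))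

/-- Time symmetry of one step: replacing (y, h) by (-y, -h) fixes the argument yh of A and reverses
the sign of the exponent hA(yh). -/
theorem midStepSeries_mul_dilate (B : ℕ → R) (y : ℝ) :
    midStepSeries B y * dilate (-1) (midStepSeries B (-y)) = 1 := by
  have h := expXMul_neg_mul_expXMul (-dilate y (PowerSeries.mk B))
  rw [neg_neg] at h
  rw [midStepSeries, midStepSeries, dilate_neg_one_expXMul, dilate_dilate, neg_one_mul, neg_neg, h]

/-- The coefficient of order `j + 1` of `midStepSeries B (x + 1 / 2)` as a polynomial in `x`. -/
noncomputable def midStepPoly (B : ℕ → R) (j : ℕ) : R[X] :=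
  ∑ r ∈ range (j + 1),
    Polynomial.C (((r + 1).factorial : ℝ)⁻¹ • PowerSeries.coeff (j - r) (PowerSeries.mk B ^ (r + 1))) *
      (Polynomial.X + Polynomial.C (algebraMap ℝ R (1 / 2))) ^ (j - r)

theorem coeff_zero_midStepSeries (B : ℕ → R) (y : ℝ) :
    PowerSeries.coeff 0 (midStepSeries B y) = 1 := by
  simp [midStepSeries, expXMul]

theorem coeff_succ_midStepSeries (B : ℕ → R) (x : ℝ) (j : ℕ) :
    PowerSeries.coeff (j + 1) (midStepSeries B (x + 1 / 2)) = realEval x (midStepPoly B j) := by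
  have hp : ∀ k : ℕ, realEval x ((Polynomial.X + Polynomial.C (algebraMap ℝ R (1 / 2))) ^ k) =
      algebraMap ℝ R ((x + 1 / 2) ^ k) := by
    intro k
    induction k with
    | zero => simp [realEval]
    | succ k ih =>
      rw [pow_succ, realEval_mul, ih, pow_succ, map_mul]
      congr 1
      simp [realEval]
  rw [midStepSeries, expXMul, coeff_mk, sum_range_succ']
  rw [pow_zero, PowerSeries.coeff_one, if_neg (Nat.succ_ne_zero j), smul_zero, add_zero]
  have he : realEval x (midStepPoly B j) = ∑ r ∈ range (j + 1), realEval x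
      (Polynomial.C (((r + 1).factorial : ℝ)⁻¹ • PowerSeries.coeff (j - r) (PowerSeries.mk B ^ (r + 1))) *
      (Polynomial.X + Polynomial.C (algebraMap ℝ R (1 / 2))) ^ (j - r)) := by
    rw [midStepPoly, realEval, eval_finsetSum]; rfl
  rw [he]
  refine sum_congr rfl fun r hr => ?_
  have hr' := mem_range.1 hr
  rw [realEval_mul, hp, coeff_X_mul_pow, if_pos (by omega), Nat.add_sub_add_right, ← map_pow,
    coeff_dilate, ← Algebra.commutes, ← Algebra.smul_def, smul_comm]
  congr 1
  simp [realEval]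

theorem natDegree_X_add_C_pow_le {R : Type*} [Ring R] (c : R) (k : ℕ) :
    ((Polynomial.X + Polynomial.C c) ^ k).natDegree ≤ k := by
  refine (natDegree_pow_le_of_le k (m := 1) ?_).trans (mul_one k).le
  exact (natDegree_add_le _ _).trans (max_le natDegree_X_le (by simp))

theorem natDegree_midStepPoly_le (B : ℕ → R) (j : ℕ) : (midStepPoly B j).natDegree ≤ j :=
  natDegree_sum_le_of_forall_le _ _ fun _ _ =>
    (natDegree_C_mul_le _ _).trans ((natDegree_X_add_C_pow_le _ _).trans (Nat.sub_le _ _))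

/-- Only the linear term of the exponential, r = 0, reaches degree j. -/
theorem coeff_midStepPoly (B : ℕ → R) (j : ℕ) : (midStepPoly B j).coeff j = B j := by
  rw [midStepPoly, finsetSum_coeff, sum_range_succ', sum_eq_zero, zero_add]
  · rw [Polynomial.coeff_C_mul]
    have h1 : ∀ k : ℕ, ((Polynomial.X + Polynomial.C (algebraMap ℝ R (1 / 2))) ^ k).coeff k = 1 := by
      intro k
      induction k with
      | zero => simp
      | succ k ih =>
        rw [pow_succ, coeff_mul_add_eq_of_natDegree_le (natDegree_X_add_C_pow_le _ k), ih]
        · simp [Polynomial.coeff_X]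
        · simpa using natDegree_X_add_C_pow_le (algebraMap ℝ R (1 / 2)) 1
    rw [Nat.sub_zero, h1]
    simp
  · intro r hr
    have := mem_range.1 hr
    rw [Polynomial.coeff_C_mul, coeff_eq_zero_of_natDegree_lt, mul_zero]
    exact (natDegree_X_add_C_pow_le _ _).trans_lt (by omega)

/-- The coefficient of order `j` of `N` consecutive steps, as a polynomial in `N`. -/
noncomputable def stepsPoly (B : ℕ → R) : ℕ → R[X]
  | 0 => 1
  | j + 1 => antidiff (∑ i : Fin (j + 1), midStepPoly B (j - i) * stepsPoly B i)

/-- The Taylor coefficients of the solution of `U' = A U`, `U(0) = 1`, where `A(s) = ∑ B_p s ^ p`. -/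
noncomputable def propagatorCoeff (B : ℕ → R) : ℕ → R
  | 0 => 1
  | j + 1 => ((j : ℝ) + 1)⁻¹ • ∑ i : Fin (j + 1), B (j - i) * propagatorCoeff B i

theorem sum_fin_eq_sum_antidiagonal {E : Type*} [AddCommMonoid E] (f : ℕ → ℕ → E) (n : ℕ) :
    ∑ i : Fin (n + 1), f (n - i) i = ∑ p ∈ antidiagonal n, f p.1 p.2 := by
  rw [Fin.sum_univ_eq_sum_range (fun i => f (n - i) i),
    ← Nat.sum_antidiagonal_eq_sum_range_succ (fun i k => f k i),
    ← Nat.sum_antidiagonal_swap]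
  rfl

theorem natDegree_stepsPoly_le (B : ℕ → R) (j : ℕ) : (stepsPoly B j).natDegree ≤ j := by
  induction j using Nat.strong_induction_on with
  | _ j ih =>
    cases j with
    | zero => simp [stepsPoly]
    | succ j =>
      rw [stepsPoly]
      refine natDegree_antidiff_le (natDegree_sum_le_of_forall_le _ _ fun i _ => ?_)
      refine natDegree_mul_le.trans ((add_le_add (natDegree_midStepPoly_le B _) (ih i i.2)).trans ?_)
      omega

/-- Top coefficients multiply, and `antidiff` divides the top one by j + 1, which reproduces the
Taylor recursion of U' = AU. -/
theorem coeff_stepsPoly (B : ℕ → R) (j : ℕ) : (stepsPoly B j).coeff j = propagatorCoeff B j := by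
  induction j using Nat.strong_induction_on with
  | _ j ih =>
    cases j with
    | zero => simp [stepsPoly, propagatorCoeff]
    | succ j =>
      rw [stepsPoly, propagatorCoeff, coeff_antidiff, finsetSum_coeff]
      · congr 1
        refine sum_congr rfl fun i _ => ?_
        have h := coeff_mul_add_eq_of_natDegree_le (natDegree_midStepPoly_le B (j - i))
          (natDegree_stepsPoly_le B i)
        rw [Nat.sub_add_cancel (Nat.lt_succ_iff.1 i.2)] at h
        rw [h, coeff_midStepPoly, ih i i.2]
      · refine natDegree_sum_le_of_forall_le _ _ fun i _ => ?_
        refine natDegree_mul_le.trans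
          ((add_le_add (natDegree_midStepPoly_le B _) (natDegree_stepsPoly_le B _)).trans ?_)
        omega

/-- The expansion in the step size of `x` consecutive steps of the midpoint rule. -/
noncomputable def stepsSeries (B : ℕ → R) (x : ℝ) : R⟦X⟧ :=
  PowerSeries.mk fun j => realEval x (stepsPoly B j)

theorem stepsSeries_add_one (B : ℕ → R) (x : ℝ) :
    stepsSeries B (x + 1) = midStepSeries B (x + 1 / 2) * stepsSeries B x := by
  ext j
  cases j with
  | zero =>
    rw [PowerSeries.coeff_mul, Nat.antidiagonal_zero, sum_singleton, coeff_zero_midStepSeries, one_mul]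
    simp [stepsSeries, stepsPoly, realEval]
  | succ j =>
    rw [PowerSeries.coeff_mul, Nat.sum_antidiagonal_succ, coeff_zero_midStepSeries, one_mul,
      stepsSeries, stepsSeries, coeff_mk, coeff_mk, stepsPoly, realEval_antidiff_add_one]
    congr 1
    have h := sum_fin_eq_sum_antidiagonal
      (fun a b => realEval x (midStepPoly B a) * realEval x (stepsPoly B b)) j
    simp only [coeff_succ_midStepSeries, coeff_mk]
    rw [← h, realEval, eval_finsetSum]
    exact sum_congr rfl fun i _ => realEval_mul x _ _

theorem stepsSeries_zero (B : ℕ → R) : stepsSeries B 0 = 1 := by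
  ext j
  rw [stepsSeries, coeff_mk, PowerSeries.coeff_one]
  cases j with
  | zero => simp [stepsPoly, realEval]
  | succ j => rw [stepsPoly, realEval_zero_antidiff, if_neg (Nat.succ_ne_zero j)]

/-- The recurrence read at -(N + 1) peels off the step centred at -(N + 1/2). After h ↦ -h this is
the inverse of the step centred at N + 1/2, so both sides obey the same recursion. -/
theorem dilate_neg_one_stepsSeries_neg (B : ℕ → R) (N : ℕ) :
    dilate (-1) (stepsSeries B (-N)) = stepsSeries B N := by
  induction N with
  | zero => simp [stepsSeries_zero]
  | succ N ih =>
    have h1 := stepsSeries_add_one B (-(N + 1 : ℕ))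
    have e1 : (-((N + 1 : ℕ) : ℝ)) + 1 = -N := by push_cast; ring
    have e2 : (-((N + 1 : ℕ) : ℝ)) + 1 / 2 = -(N + 1 / 2) := by push_cast; ring
    rw [e1, e2] at h1
    rw [Nat.cast_succ, stepsSeries_add_one B N, ← ih, h1, map_mul, ← mul_assoc,
      midStepSeries_mul_dilate, one_mul, Nat.cast_succ]

theorem sum_smul_coeff_stepsSeries (B : ℕ → R) {M : ℕ} (hM : 1 ≤ M) {k : Fin M → ℕ} {a : Fin M → ℝ}
    (hk : ∀ i, 0 < k i) (hV : SatisfiesVandermonde k a) {j : ℕ} (hj : j ≤ 2 * M) :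
    ∑ i, a i • ((k i : ℝ)⁻¹) ^ j • PowerSeries.coeff j (stepsSeries B (k i)) =
      propagatorCoeff B j := by
  set c : ℕ → R := fun n => (stepsPoly B j).coeff n with hc
  have hc0 : j ≠ 0 → c 0 = 0 := by
    intro hj0
    have h := congrArg (PowerSeries.coeff j) (stepsSeries_zero B)
    rw [stepsSeries, coeff_mk, PowerSeries.coeff_one, if_neg hj0, realEval, map_zero,
      ← coeff_zero_eq_eval_zero] at h
    exact h
  -- Averaging the expansions at m and -m cancels the powers of the wrong parity, with no need to
  -- compare polynomial coefficients.
  have heven : ∀ m : ℕ, PowerSeries.coeff j (stepsSeries B m) =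
      ∑ n ∈ range (j + 1), ((1 + (-1) ^ (n + j)) / 2 * (m : ℝ) ^ n) • c n := by
    intro m
    have h1 : PowerSeries.coeff j (stepsSeries B m) = ∑ n ∈ range (j + 1), (m : ℝ) ^ n • c n := by
      rw [stepsSeries, coeff_mk, realEval_eq_sum _ (natDegree_stepsPoly_le B j)]
    have h2 : PowerSeries.coeff j (stepsSeries B m) =
        ∑ n ∈ range (j + 1), ((-1) ^ j * (-(m : ℝ)) ^ n) • c n := by
      rw [← dilate_neg_one_stepsSeries_neg, coeff_dilate, stepsSeries, coeff_mk,
        realEval_eq_sum _ (natDegree_stepsPoly_le B j), smul_sum]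
      exact sum_congr rfl fun n _ => smul_smul _ _ _
    have h3 : PowerSeries.coeff j (stepsSeries B m) = (1 / 2 : ℝ) •
        (PowerSeries.coeff j (stepsSeries B m) + PowerSeries.coeff j (stepsSeries B m)) := by
      rw [← two_smul ℝ, smul_smul]; norm_num
    rw [h3]
    nth_rw 1 [h1]
    rw [h2, ← sum_add_distrib, smul_sum]
    refine sum_congr rfl fun n _ => ?_
    rw [← add_smul, smul_smul]
    congr 1
    rw [neg_pow, pow_add]; ring
  -- Here j - n = 2l, and n ≥ 1 with j ≤ 2M forces l ≤ M - 1. Without `hc0` the case n = 0, j = 2M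
  -- would need the unavailable equation l = M.
  have hsum : ∀ n ∈ range (j + 1), n ≠ j →
      (∑ i, a i * ((k i : ℝ)⁻¹ ^ j * ((1 + (-1) ^ (n + j)) / 2 * (k i : ℝ) ^ n))) • c n = 0 := by
    intro n hn hnj
    have hn' : n < j := by have := mem_range.1 hn; omega
    rcases Nat.even_or_odd (n + j) with he | ho
    · rcases Nat.eq_zero_or_pos n with rfl | hn0
      · rw [hc0 (by omega), smul_zero]
      · obtain ⟨l, hl⟩ : ∃ l, j = n + 2 * l := by
          obtain ⟨q, hq⟩ := he
          exact ⟨q - n, by omega⟩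
        have hv := hV l (by omega)
        rw [if_neg (by omega)] at hv
        rw [← zero_smul ℝ (c n), ← hv]
        congr 1
        refine sum_congr rfl fun i _ => ?_
        have hki : (k i : ℝ) ≠ 0 := by exact_mod_cast (hk i).ne'
        rw [he.neg_one_pow, hl]
        congr 1
        rw [inv_pow, pow_add]
        field_simp
        norm_num
    · simp [ho.neg_one_pow]
  calc ∑ i, a i • ((k i : ℝ)⁻¹) ^ j • PowerSeries.coeff j (stepsSeries B (k i))
      = ∑ n ∈ range (j + 1),
        (∑ i, a i * ((k i : ℝ)⁻¹ ^ j * ((1 + (-1) ^ (n + j)) / 2 * (k i : ℝ) ^ n))) • c n := by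
        simp only [heven, smul_sum, sum_smul, smul_smul]
        exact sum_comm
    _ = c j := by
        rw [sum_eq_single_of_mem j (self_mem_range_succ j) hsum]
        have hv := hV 0 hM
        simp only [mul_zero, pow_zero, inv_one, mul_one, if_true] at hv
        conv_rhs => rw [← one_smul ℝ (c j)]
        congr 1
        refine Eq.trans (sum_congr rfl fun i _ => ?_) hv
        have hki : (k i : ℝ) ≠ 0 := by exact_mod_cast (hk i).ne'
        rw [← two_mul, pow_mul, neg_one_sq, one_pow, inv_pow]
        field_simp
        norm_num
    _ = _ := coeff_stepsPoly B j

end FormalMidpoint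

/-! ### Weighted norms and evaluation of power series over a Banach algebra -/

namespace PowerSeries

open Finset
open scoped ENNReal NNReal

variable {R : Type*} [NormedRing R]

/-- The weighted `ℓ¹` norm `∑ ‖p_n‖ ρ ^ n` of a power series. -/
noncomputable def wnorm (ρ : ℝ≥0) (p : R⟦X⟧) : ℝ≥0∞ := ∑' n, ‖coeff n p‖ₑ * (ρ : ℝ≥0∞) ^ n

theorem wnorm_mul_le (ρ : ℝ≥0) (p q : R⟦X⟧) : wnorm ρ (p * q) ≤ wnorm ρ p * wnorm ρ q := by
  have h : wnorm ρ p * wnorm ρ q = ∑' n, ∑ ij ∈ antidiagonal n,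
      (‖coeff ij.1 p‖ₑ * (ρ : ℝ≥0∞) ^ ij.1) * (‖coeff ij.2 q‖ₑ * (ρ : ℝ≥0∞) ^ ij.2) := by
    rw [wnorm, wnorm, ← ENNReal.tsum_mul_right]
    simp_rw [← ENNReal.tsum_mul_left]
    rw [← ENNReal.tsum_prod (f := fun i j =>
      (‖coeff i p‖ₑ * (ρ : ℝ≥0∞) ^ i) * (‖coeff j q‖ₑ * (ρ : ℝ≥0∞) ^ j)),
      ← HasAntidiagonal.sigmaAntidiagonalEquivProd.tsum_eq, ENNReal.tsum_sigma']
    refine tsum_congr fun n => ?_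
    rw [tsum_fintype, ← sum_coe_sort (antidiagonal n) (fun ij =>
      (‖coeff ij.1 p‖ₑ * (ρ : ℝ≥0∞) ^ ij.1) * (‖coeff ij.2 q‖ₑ * (ρ : ℝ≥0∞) ^ ij.2))]
    rfl
  rw [h]
  refine ENNReal.tsum_le_tsum fun n => ?_
  rw [coeff_mul]
  calc ‖∑ ij ∈ antidiagonal n, coeff ij.1 p * coeff ij.2 q‖ₑ * (ρ : ℝ≥0∞) ^ n
      ≤ (∑ ij ∈ antidiagonal n, ‖coeff ij.1 p‖ₑ * ‖coeff ij.2 q‖ₑ) * (ρ : ℝ≥0∞) ^ n := by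
        gcongr
        refine (enorm_sum_le _ _).trans (sum_le_sum fun ij _ => ?_)
        rw [enorm_eq_nnnorm, enorm_eq_nnnorm, enorm_eq_nnnorm, ← ENNReal.coe_mul]
        exact ENNReal.coe_le_coe.2 (nnnorm_mul_le _ _)
    _ = _ := by
        rw [sum_mul]
        refine sum_congr rfl fun ij hij => ?_
        rw [← mem_antidiagonal.1 hij, pow_add]
        ring

theorem wnorm_one [NormOneClass R] (ρ : ℝ≥0) : wnorm ρ (1 : R⟦X⟧) = 1 := by
  rw [wnorm, tsum_eq_single 0]
  · simp
  · intro n hn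
    simp [coeff_one, hn]

theorem wnorm_pow_le [NormOneClass R] (ρ : ℝ≥0) (p : R⟦X⟧) (n : ℕ) :
    wnorm ρ (p ^ n) ≤ wnorm ρ p ^ n := by
  induction n with
  | zero => simp [wnorm_one]
  | succ n ih =>
    rw [pow_succ, pow_succ]
    exact (wnorm_mul_le _ _ _).trans (by gcongr)

theorem wnorm_sub_le (ρ : ℝ≥0) (p q : R⟦X⟧) : wnorm ρ (p - q) ≤ wnorm ρ p + wnorm ρ q := by
  rw [wnorm, wnorm, wnorm, ← ENNReal.tsum_add]
  refine ENNReal.tsum_le_tsum fun n => ?_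
  rw [← add_mul, map_sub]
  gcongr
  exact enorm_sub_le

theorem wnorm_sum_le {ι : Type*} (s : Finset ι) (ρ : ℝ≥0) (p : ι → R⟦X⟧) :
    wnorm ρ (∑ i ∈ s, p i) ≤ ∑ i ∈ s, wnorm ρ (p i) := by
  simp only [wnorm]
  rw [← Summable.tsum_finsetSum fun _ _ => ENNReal.summable]
  refine ENNReal.tsum_le_tsum fun n => ?_
  rw [← sum_mul, map_sum]
  gcongr
  exact enorm_sum_le _ _

variable [NormedAlgebra ℝ R]

theorem wnorm_smul (ρ : ℝ≥0) (c : ℝ) (p : R⟦X⟧) : wnorm ρ (c • p) = ‖c‖ₑ * wnorm ρ p := by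
  simp only [wnorm]
  rw [← ENNReal.tsum_mul_left]
  refine tsum_congr fun n => ?_
  rw [coeff_smul, enorm_smul, mul_assoc]

theorem wnorm_dilate (ρ c : ℝ≥0) (p : R⟦X⟧) : wnorm ρ (dilate c p) = wnorm (ρ * c) p := by
  simp only [wnorm]
  refine tsum_congr fun n => ?_
  rw [coeff_dilate, enorm_smul, enorm_pow, ENNReal.coe_mul, mul_pow]
  have : ‖(c : ℝ)‖ₑ = c := by simp
  rw [this]; ring

theorem enorm_inv_factorial_smul_pow_le [NormOneClass R] (ρ : ℝ≥0) (p : R⟦X⟧) :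
    ∑' r : ℕ, ∑' j : ℕ, ‖(r.factorial : ℝ)⁻¹ • coeff j ((X * p) ^ r)‖ₑ * (ρ : ℝ≥0∞) ^ j ≤
      ∑' r : ℕ, ‖(r.factorial : ℝ)⁻¹‖ₑ * wnorm ρ (X * p) ^ r := by
  refine ENNReal.tsum_le_tsum fun r => ?_
  have := wnorm_smul ρ (r.factorial : ℝ)⁻¹ ((X * p) ^ r)
  simp only [wnorm, coeff_smul] at this
  rw [this]
  gcongr
  exact wnorm_pow_le _ _ _

theorem tsum_inv_factorial_mul_le {w : ℝ≥0∞} {c : ℝ} (hc : 0 ≤ c) (h : w ≤ ENNReal.ofReal c) :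
    ∑' r : ℕ, ‖(r.factorial : ℝ)⁻¹‖ₑ * w ^ r ≤ ENNReal.ofReal (Real.exp c) := by
  have h1 : Real.exp c = ∑' r : ℕ, (r.factorial : ℝ)⁻¹ * c ^ r := by
    rw [Real.exp_eq_exp_ℝ, NormedSpace.exp_eq_tsum ℝ]
    simp
  rw [h1, ENNReal.ofReal_tsum_of_nonneg (fun r => by positivity)]
  · refine ENNReal.tsum_le_tsum fun r => ?_
    rw [ENNReal.ofReal_mul (by positivity), ENNReal.ofReal_pow hc, Real.enorm_eq_ofReal (by positivity)]
    gcongr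
  · simpa [div_eq_inv_mul] using Real.summable_pow_div_factorial c

theorem wnorm_expXMul_le [NormOneClass R] {ρ : ℝ≥0} {p : R⟦X⟧} {c : ℝ} (hc : 0 ≤ c)
    (h : wnorm ρ (X * p) ≤ ENNReal.ofReal c) :
    wnorm ρ (expXMul p) ≤ ENNReal.ofReal (Real.exp c) := by
  refine le_trans ?_ ((enorm_inv_factorial_smul_pow_le ρ p).trans (tsum_inv_factorial_mul_le hc h))
  rw [ENNReal.tsum_comm]
  refine ENNReal.tsum_le_tsum fun j => ?_
  rw [ENNReal.tsum_mul_right]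
  gcongr
  rw [expXMul, coeff_mk]
  exact (enorm_sum_le _ _).trans (ENNReal.sum_le_tsum _)

/-- Evaluation of a power series at a real point. -/
noncomputable def realEval (s : ℝ) (p : R⟦X⟧) : R := ∑' n, s ^ n • coeff n p

theorem summable_norm_of_wnorm {ρ : ℝ≥0} {p : R⟦X⟧} (h : wnorm ρ p ≠ ⊤) {s : ℝ} (hs : |s| ≤ ρ) :
    Summable fun n => ‖s ^ n • coeff n p‖ := by
  have h1 : Summable fun n => (‖coeff n p‖₊ * ρ ^ n : ℝ≥0) := by
    rw [← ENNReal.tsum_coe_ne_top_iff_summable]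
    convert h using 1
    refine tsum_congr fun n => ?_
    push_cast; rfl
  refine Summable.of_nonneg_of_le (fun _ => norm_nonneg _) (fun n => ?_) (NNReal.summable_coe.2 h1)
  rw [norm_smul, norm_pow, Real.norm_eq_abs, mul_comm]
  push_cast
  gcongr

/-- Replaces a Cauchy estimate: each surviving term shrinks by at least (s/ρ)^n between radius ρ and
s, so vanishing low orders become a power of s/ρ. -/
theorem norm_realEval_le {ρ : ℝ≥0} {p : R⟦X⟧} {C : ℝ} (hC : 0 ≤ C) (h : wnorm ρ p ≤ ENNReal.ofReal C)
    {s : ℝ} (hs0 : 0 ≤ s) (hs : s ≤ ρ) (hρ : 0 < ρ) {n : ℕ} (hn : ∀ j < n, coeff j p = 0) :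
    ‖realEval s p‖ ≤ (s / ρ) ^ n * C := by
  rw [← toReal_enorm, realEval]
  refine ENNReal.toReal_le_of_le_ofReal (by positivity) ?_
  refine (enorm_tsum_le_tsum_enorm).trans ?_
  rw [ENNReal.ofReal_mul (by positivity)]
  refine le_trans ?_ (mul_le_mul_right h _)
  rw [wnorm, ← ENNReal.tsum_mul_left]
  refine ENNReal.tsum_le_tsum fun j => ?_
  rcases lt_or_ge j n with hj | hj
  · simp [hn j hj]
  · rw [enorm_smul, enorm_pow, mul_comm, mul_left_comm]
    gcongr
    have h1 : ((ρ : ℝ≥0∞)) = ENNReal.ofReal ρ := by simp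
    have h2 : s / ρ ≤ 1 := (div_le_one (by exact_mod_cast hρ)).2 hs
    have hρ' : (ρ : ℝ) ≠ 0 := by exact_mod_cast hρ.ne'
    rw [h1, Real.enorm_eq_ofReal hs0, ← ENNReal.ofReal_pow hs0, ← ENNReal.ofReal_pow (by positivity),
      ← ENNReal.ofReal_mul (by positivity)]
    refine ENNReal.ofReal_le_ofReal ?_
    calc s ^ j = (s / ρ) ^ j * ρ ^ j := by rw [← mul_pow, div_mul_cancel₀ _ hρ']
      _ ≤ (s / ρ) ^ n * ρ ^ j := by
        gcongr ?_ * _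
        exact pow_le_pow_of_le_one (by positivity) h2 hj

theorem realEval_dilate (s c : ℝ) (p : R⟦X⟧) : realEval s (dilate c p) = realEval (s * c) p := by
  rw [realEval, realEval]
  refine tsum_congr fun n => ?_
  rw [coeff_dilate, smul_smul, mul_pow]

theorem realEval_one (s : ℝ) : realEval s (1 : R⟦X⟧) = 1 := by
  rw [realEval, tsum_eq_single 0]
  · simp
  · intro n hn
    simp [coeff_one, hn]

theorem realEval_smul (s c : ℝ) (p : R⟦X⟧) : realEval s (c • p) = c • realEval s p := by
  simp only [realEval]
  rw [← tsum_const_smul'']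
  exact tsum_congr fun n => by rw [coeff_smul, smul_comm]

theorem realEval_X_mul (s : ℝ) (p : R⟦X⟧) (hp : Summable fun n => s ^ n • coeff n (X * p)) :
    realEval s (X * p) = s • realEval s p := by
  rw [realEval, hp.tsum_eq_zero_add, coeff_zero_X_mul, smul_zero, zero_add, realEval,
    ← tsum_const_smul'']
  refine tsum_congr fun n => ?_
  rw [coeff_succ_X_mul, smul_smul, pow_succ']

variable [CompleteSpace R]

theorem realEval_sub {ρ : ℝ≥0} {p q : R⟦X⟧} (hp : wnorm ρ p ≠ ⊤) (hq : wnorm ρ q ≠ ⊤) {s : ℝ}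
    (hs : |s| ≤ ρ) : realEval s (p - q) = realEval s p - realEval s q := by
  simp only [realEval]
  rw [← (summable_norm_of_wnorm hp hs).of_norm.tsum_sub (summable_norm_of_wnorm hq hs).of_norm]
  exact tsum_congr fun n => by rw [map_sub, smul_sub]

theorem realEval_sum {ι : Type*} (t : Finset ι) {ρ : ℝ≥0} {p : ι → R⟦X⟧}
    (hp : ∀ i ∈ t, wnorm ρ (p i) ≠ ⊤) {s : ℝ} (hs : |s| ≤ ρ) :
    realEval s (∑ i ∈ t, p i) = ∑ i ∈ t, realEval s (p i) := by
  simp only [realEval]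
  rw [← Summable.tsum_finsetSum fun i hi => (summable_norm_of_wnorm (hp i hi) hs).of_norm]
  exact tsum_congr fun n => by rw [map_sum, smul_sum]

theorem realEval_mul {ρ : ℝ≥0} {p q : R⟦X⟧} (hp : wnorm ρ p ≠ ⊤) (hq : wnorm ρ q ≠ ⊤) {s : ℝ}
    (hs : |s| ≤ ρ) : realEval s (p * q) = realEval s p * realEval s q := by
  simp only [realEval]
  rw [tsum_mul_tsum_eq_tsum_sum_antidiagonal_of_summable_norm (summable_norm_of_wnorm hp hs)
    (summable_norm_of_wnorm hq hs)]
  refine tsum_congr fun n => ?_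
  rw [coeff_mul, smul_sum]
  refine sum_congr rfl fun ij hij => ?_
  rw [smul_mul_smul_comm, ← pow_add, mem_antidiagonal.1 hij]

theorem realEval_pow [NormOneClass R] {ρ : ℝ≥0} {p : R⟦X⟧} (hp : wnorm ρ p ≠ ⊤) {s : ℝ}
    (hs : |s| ≤ ρ) (n : ℕ) : realEval s (p ^ n) = realEval s p ^ n := by
  induction n with
  | zero => simp [realEval_one]
  | succ n ih =>
    rw [pow_succ, pow_succ, realEval_mul _ hp hs, ih]
    exact ne_top_of_le_ne_top (ENNReal.pow_ne_top hp) (wnorm_pow_le _ _ _)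

/-- The double series over exponential order and degree is absolutely summable, dominated by the
exponential of the weighted norm of X p, so the two sums may be exchanged. -/
theorem realEval_expXMul [NormOneClass R] {ρ : ℝ≥0} {p : R⟦X⟧} (hp : wnorm ρ (X * p) ≠ ⊤) {s : ℝ}
    (hs : |s| ≤ ρ) : realEval s (expXMul p) = NormedSpace.exp (s • realEval s p) := by
  rw [← realEval_X_mul s p (summable_norm_of_wnorm hp hs).of_norm, NormedSpace.exp_eq_tsum ℝ]
  set f : ℕ × ℕ → R := fun rj => s ^ rj.2 • (rj.1.factorial : ℝ)⁻¹ • coeff rj.2 ((X * p) ^ rj.1)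
    with hf
  have hfin : ∑' rj, ‖f rj‖ₑ ≠ ⊤ := by
    refine ne_top_of_le_ne_top (ENNReal.ofReal_ne_top (r := Real.exp (wnorm ρ (X * p)).toReal)) ?_
    refine le_trans ?_ ((enorm_inv_factorial_smul_pow_le ρ p).trans
      (tsum_inv_factorial_mul_le ENNReal.toReal_nonneg (ENNReal.ofReal_toReal hp).ge))
    rw [ENNReal.tsum_prod']
    refine ENNReal.tsum_le_tsum fun r => ENNReal.tsum_le_tsum fun j => ?_
    rw [hf, enorm_smul, mul_comm, enorm_pow]
    gcongr
    rw [← ofReal_norm, Real.norm_eq_abs]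
    exact ENNReal.ofReal_le_of_le_toReal hs
  have hsum : Summable f := by
    refine Summable.of_norm ?_
    have h1 : Summable fun rj => ‖f rj‖₊ := ENNReal.tsum_coe_ne_top_iff_summable.1 hfin
    exact NNReal.summable_coe.2 h1
  have hrow : ∀ j, ∑' r, f (r, j) = s ^ j • coeff j (expXMul p) := by
    intro j
    rw [tsum_eq_sum (s := range (j + 1)), expXMul, coeff_mk, smul_sum]
    intro r hr
    simp only [hf]
    rw [coeff_X_mul_pow, if_neg (by simpa using hr), smul_zero, smul_zero]
  rw [realEval]
  simp_rw [← hrow]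
  have := hsum.tsum_comm (f := fun r j => f (r, j))
  rw [this]
  refine tsum_congr fun r => ?_
  rw [← realEval_pow hp hs, realEval, ← tsum_const_smul'']
  exact tsum_congr fun j => by rw [hf, smul_comm]

end PowerSeries

/-! ### Convergent expansions of the midpoint rule and of the propagator -/

section Convergence

open Finset PowerSeries
open scoped ENNReal NNReal

variable {R : Type*} [NormedRing R] [NormedAlgebra ℝ R]

theorem wnorm_X_mul_dilate_mk_le {B : ℕ → R} {Λ : ℝ} (hΛ : 0 ≤ Λ)
    (hB : ∀ p : ℕ, ‖B p‖ ≤ Λ ^ (p + 1) / p.factorial) (ρ : ℝ≥0) {y : ℝ} (hy : 0 ≤ y) :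
    wnorm ρ (X * dilate y (mk B)) ≤ ENNReal.ofReal (Λ * ρ * Real.exp (Λ * y * ρ)) := by
  have h1 : Λ * ρ * Real.exp (Λ * y * ρ) =
      ∑' n : ℕ, Λ * ρ * ((Λ * y * ρ) ^ n / (n.factorial : ℝ)) := by
    rw [tsum_mul_left, Real.exp_eq_exp_ℝ, NormedSpace.exp_eq_tsum_div]
  rw [h1, ENNReal.ofReal_tsum_of_nonneg (fun n => by positivity)
    ((Real.summable_pow_div_factorial _).mul_left _), wnorm, tsum_eq_zero_add' ENNReal.summable,
    coeff_zero_X_mul, enorm_zero, zero_mul, zero_add]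
  refine ENNReal.tsum_le_tsum fun n => ?_
  rw [coeff_succ_X_mul, coeff_dilate, coeff_mk, ← ofReal_norm, ← ENNReal.ofReal_coe_nnreal,
    ← ENNReal.ofReal_pow ρ.coe_nonneg, ← ENNReal.ofReal_mul (norm_nonneg _)]
  refine ENNReal.ofReal_le_ofReal ?_
  rw [norm_smul, norm_pow, Real.norm_of_nonneg hy]
  calc y ^ n * ‖B n‖ * (ρ : ℝ) ^ (n + 1)
      ≤ y ^ n * (Λ ^ (n + 1) / n.factorial) * (ρ : ℝ) ^ (n + 1) := by gcongr; exact hB n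
    _ = _ := by rw [mul_pow, mul_pow]; ring

theorem wnorm_mk_le {R : Type*} [NormedRing R] {B : ℕ → R} {Λ : ℝ} (hΛ : 0 ≤ Λ)
    (hB : ∀ p : ℕ, ‖B p‖ ≤ Λ ^ (p + 1) / p.factorial) {ρ : ℝ≥0} (hρ : Λ * ρ ≤ 1 / 2) :
    wnorm ρ (mk B) ≤ ENNReal.ofReal (Λ * 2) := by
  rw [← tsum_geometric_two, ← tsum_mul_left, ENNReal.ofReal_tsum_of_nonneg (fun n => by positivity)
    (summable_geometric_two.mul_left _), wnorm]
  refine ENNReal.tsum_le_tsum fun n => ?_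
  rw [coeff_mk, ← ofReal_norm, ← ENNReal.ofReal_coe_nnreal,
    ← ENNReal.ofReal_pow ρ.coe_nonneg, ← ENNReal.ofReal_mul (norm_nonneg _)]
  refine ENNReal.ofReal_le_ofReal ?_
  calc ‖B n‖ * (ρ : ℝ) ^ n ≤ Λ ^ (n + 1) * (ρ : ℝ) ^ n := by
        gcongr
        refine (hB n).trans (div_le_self (by positivity) (by exact_mod_cast Nat.factorial_pos _))
    _ = Λ * (Λ * ρ) ^ n := by ring
    _ ≤ _ := by gcongr

theorem succ_smul_propagatorCoeff (B : ℕ → R) (j : ℕ) :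
    ((j : ℝ) + 1) • propagatorCoeff B (j + 1) = coeff j (mk B * mk (propagatorCoeff B)) := by
  rw [propagatorCoeff, smul_inv_smul₀ (by positivity),
    sum_fin_eq_sum_antidiagonal (fun a b => B a * propagatorCoeff B b), coeff_mul]
  simp only [coeff_mk]

variable [NormOneClass R]

/-- One of m steps costs only exp(1/m), because Λσ exp(Λyσ) ≤ exp(1/2)/(2m) ≤ 1/m. Hence all m steps
together cost at most e < 3, whatever m is. -/
theorem wnorm_midStepSeries_le {B : ℕ → R} {Λ : ℝ} (hΛ : 0 ≤ Λ)
    (hB : ∀ p : ℕ, ‖B p‖ ≤ Λ ^ (p + 1) / p.factorial) {σ : ℝ≥0} {m : ℕ} (hm : 0 < m)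
    (hσ : Λ * (m * σ) ≤ 1 / 2) {y : ℝ} (hy : 0 ≤ y) (hym : y ≤ m) :
    wnorm σ (midStepSeries B y) ≤ ENNReal.ofReal (Real.exp (1 / m)) := by
  have hm' : (0 : ℝ) < m := by exact_mod_cast hm
  refine wnorm_expXMul_le (by positivity) ((wnorm_X_mul_dilate_mk_le hΛ hB σ hy).trans ?_)
  refine ENNReal.ofReal_le_ofReal ?_
  have h1 : Λ * y * σ ≤ 1 / 2 := by
    calc Λ * y * σ ≤ Λ * m * σ := by gcongr
      _ ≤ 1 / 2 := by rw [mul_assoc]; exact hσ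
  have h2 : Real.exp (Λ * y * σ) ≤ 2 := by
    refine (Real.exp_le_exp.2 h1).trans ?_
    refine (Real.exp_bound_div_one_sub_of_interval (by norm_num) (by norm_num)).trans ?_
    norm_num
  have h3 : Λ * σ ≤ 1 / 2 / m := by
    rw [le_div_iff₀ hm']
    calc Λ * σ * m = Λ * (m * σ) := by ring
      _ ≤ 1 / 2 := hσ
  calc Λ * σ * Real.exp (Λ * y * σ) ≤ 1 / 2 / m * 2 := by gcongr
    _ = 1 / m := by ring

theorem wnorm_stepsSeries_le {B : ℕ → R} {Λ : ℝ} (hΛ : 0 ≤ Λ)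
    (hB : ∀ p : ℕ, ‖B p‖ ≤ Λ ^ (p + 1) / p.factorial) {σ : ℝ≥0} {m : ℕ} (hm : 0 < m)
    (hσ : Λ * (m * σ) ≤ 1 / 2) {N : ℕ} (hN : N ≤ m) :
    wnorm σ (stepsSeries B N) ≤ ENNReal.ofReal (Real.exp (1 / m)) ^ N := by
  induction N with
  | zero => rw [Nat.cast_zero, stepsSeries_zero, wnorm_one, pow_zero]
  | succ N ih =>
    have hN' : (N : ℝ) + 1 ≤ m := by exact_mod_cast hN
    rw [Nat.cast_succ, stepsSeries_add_one, pow_succ']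
    refine (wnorm_mul_le _ _ _).trans ?_
    gcongr
    · exact wnorm_midStepSeries_le hΛ hB hm hσ (by positivity) (by linarith)
    · exact ih (by omega)

theorem wnorm_stepsSeries_le_three {B : ℕ → R} {Λ : ℝ} (hΛ : 0 ≤ Λ)
    (hB : ∀ p : ℕ, ‖B p‖ ≤ Λ ^ (p + 1) / p.factorial) {σ : ℝ≥0} {m : ℕ} (hm : 0 < m)
    (hσ : Λ * (m * σ) ≤ 1 / 2) : wnorm σ (stepsSeries B m) ≤ ENNReal.ofReal 3 := by
  refine (wnorm_stepsSeries_le hΛ hB hm hσ le_rfl).trans ?_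
  rw [← ENNReal.ofReal_pow (Real.exp_nonneg _), ← Real.exp_nat_mul, mul_one_div_cancel
    (by exact_mod_cast hm.ne')]
  exact ENNReal.ofReal_le_ofReal (by linarith [Real.exp_one_lt_d9])

theorem norm_propagatorCoeff_le {B : ℕ → R} {Λ : ℝ} (hΛ : 0 ≤ Λ)
    (hB : ∀ p : ℕ, ‖B p‖ ≤ Λ ^ (p + 1) / p.factorial) (j : ℕ) :
    ‖propagatorCoeff B j‖ ≤ Λ ^ j := by
  induction j using Nat.strong_induction_on with
  | _ j ih =>
    cases j with
    | zero => simp [propagatorCoeff]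
    | succ j =>
      rw [propagatorCoeff, norm_smul, norm_inv, Real.norm_of_nonneg (by positivity),
        inv_mul_le_iff₀ (by positivity)]
      refine (norm_sum_le _ _).trans ?_
      calc ∑ i : Fin (j + 1), ‖B (j - i) * propagatorCoeff B i‖
          ≤ ∑ _i : Fin (j + 1), Λ ^ (j + 1) := by
            refine sum_le_sum fun i _ => (norm_mul_le _ _).trans ?_
            have hi := Nat.lt_succ_iff.1 i.2
            calc ‖B (j - i)‖ * ‖propagatorCoeff B i‖
                ≤ (Λ ^ (j - i + 1) / (j - i : ℕ).factorial) * Λ ^ (i : ℕ) := by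
                  gcongr
                  · exact hB _
                  · exact ih i i.2
              _ ≤ Λ ^ (j - i + 1 : ℕ) * Λ ^ (i : ℕ) := by
                  gcongr
                  exact div_le_self (by positivity) (by exact_mod_cast Nat.factorial_pos _)
              _ = Λ ^ (j + 1) := by rw [← pow_add]; congr 1; omega
        _ = (j + 1) * Λ ^ (j + 1) := by simp

theorem wnorm_mk_propagatorCoeff_le {B : ℕ → R} {Λ : ℝ} (hΛ : 0 ≤ Λ)
    (hB : ∀ p : ℕ, ‖B p‖ ≤ Λ ^ (p + 1) / p.factorial) {ρ : ℝ≥0} (hρ : Λ * ρ ≤ 1 / 2) :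
    wnorm ρ (mk (propagatorCoeff B)) ≤ ENNReal.ofReal 2 := by
  rw [← tsum_geometric_two, ENNReal.ofReal_tsum_of_nonneg (fun n => by positivity)
    summable_geometric_two, wnorm]
  refine ENNReal.tsum_le_tsum fun n => ?_
  rw [coeff_mk, ← ofReal_norm, ← ENNReal.ofReal_coe_nnreal,
    ← ENNReal.ofReal_pow ρ.coe_nonneg, ← ENNReal.ofReal_mul (norm_nonneg _)]
  refine ENNReal.ofReal_le_ofReal ?_
  calc ‖propagatorCoeff B n‖ * (ρ : ℝ) ^ n ≤ Λ ^ n * (ρ : ℝ) ^ n := by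
        gcongr; exact norm_propagatorCoeff_le hΛ hB n
    _ = (Λ * ρ) ^ n := (mul_pow _ _ _).symm
    _ ≤ _ := by gcongr

variable [CompleteSpace R]

theorem realEval_stepsSeries {B : ℕ → R} {Λ : ℝ} (hΛ : 0 ≤ Λ)
    (hB : ∀ p : ℕ, ‖B p‖ ≤ Λ ^ (p + 1) / p.factorial) {σ : ℝ≥0} {m : ℕ} (hm : 0 < m)
    (hσ : Λ * (m * σ) ≤ 1 / 2) {h : ℝ} (hh : |h| ≤ σ) {N : ℕ} (hN : N ≤ m) :
    realEval h (stepsSeries B N) = orderedProd (fun q : ℕ =>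
      NormedSpace.exp (h • realEval (h * (q + 1 / 2)) (mk B))) N := by
  induction N with
  | zero => rw [Nat.cast_zero, stepsSeries_zero, realEval_one, orderedProd]
  | succ N ih =>
    have hN' : (N : ℝ) + 1 ≤ m := by exact_mod_cast hN
    rw [Nat.cast_succ, stepsSeries_add_one, realEval_mul _ _ hh, ih (by omega), orderedProd]
    · congr 1
      rw [midStepSeries, realEval_expXMul _ hh, realEval_dilate]
      exact ne_top_of_le_ne_top ENNReal.ofReal_ne_top
        (wnorm_X_mul_dilate_mk_le hΛ hB σ (by positivity))
    · exact ne_top_of_le_ne_top ENNReal.ofReal_ne_top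
        (wnorm_midStepSeries_le hΛ hB hm hσ (by positivity) (by linarith))
    · exact ne_top_of_le_ne_top (ENNReal.pow_ne_top ENNReal.ofReal_ne_top)
        (wnorm_stepsSeries_le hΛ hB hm hσ (by omega))

/-- Formal cancellation through order 2M meets the uniform norm bounds, 2 for the propagator and 3
per composed formula. -/
theorem norm_realEval_sub_multiproduct_le {B : ℕ → R} {Λ : ℝ} (hΛ : 0 < Λ)
    (hB : ∀ p : ℕ, ‖B p‖ ≤ Λ ^ (p + 1) / p.factorial) {M : ℕ} (hM : 1 ≤ M) {k : Fin M → ℕ}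
    {a : Fin M → ℝ} (hk : ∀ i, 0 < k i) (hV : SatisfiesVandermonde k a) {s : ℝ} (hs0 : 0 ≤ s)
    (hs : Λ * s ≤ 1 / 2) :
    ‖realEval s (mk (propagatorCoeff B)) - ∑ i, a i • orderedProd (fun q : ℕ =>
        NormedSpace.exp ((s / k i) • realEval (s / k i * (q + 1 / 2)) (mk B))) (k i)‖ ≤
      (2 * Λ * s) ^ (2 * M + 1) * (2 + 3 * ∑ i, |a i|) := by
  set ρ : ℝ≥0 := ⟨1 / (2 * Λ), by positivity⟩ with hρdef
  have hρ : (ρ : ℝ) = 1 / (2 * Λ) := rfl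
  have hρ0 : 0 < ρ := by rw [← NNReal.coe_pos, hρ]; positivity
  have hΛρ : Λ * ρ ≤ 1 / 2 := by rw [hρ]; apply le_of_eq; field_simp
  have hsρ : s ≤ ρ := by rw [hρ, le_div_iff₀ (by positivity)]; linarith
  have hsabs : |s| ≤ ρ := by rwa [abs_of_nonneg hs0]
  set c : Fin M → ℝ≥0 := fun i => (k i : ℝ≥0)⁻¹ with hc
  have hkpos : ∀ i, (0 : ℝ) < k i := fun i => by exact_mod_cast hk i
  have hcρ : ∀ i, Λ * (k i * (ρ * c i : ℝ≥0)) ≤ 1 / 2 := by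
    intro i
    rw [hc]
    push_cast
    rw [mul_left_comm (k i : ℝ), mul_inv_cancel₀ (hkpos i).ne', mul_one]
    exact hΛρ
  have hw : ∀ i, wnorm ρ (dilate (c i) (stepsSeries B (k i))) ≤ ENNReal.ofReal 3 := fun i => by
    rw [wnorm_dilate]
    exact wnorm_stepsSeries_le_three hΛ.le hB (hk i) (hcρ i)
  have hws : ∀ i, wnorm ρ (a i • dilate (c i) (stepsSeries B (k i))) ≤
      ENNReal.ofReal (3 * |a i|) := fun i => by
    rw [mul_comm, ENNReal.ofReal_mul (abs_nonneg _), ← Real.norm_eq_abs, ofReal_norm]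
    refine (wnorm_smul _ _ _).trans_le ?_
    gcongr
    exact hw i
  have hwsum : wnorm ρ (∑ i, a i • dilate (c i) (stepsSeries B (k i))) ≤
      ENNReal.ofReal (3 * ∑ i, |a i|) := by
    rw [mul_sum, ENNReal.ofReal_sum_of_nonneg fun i _ => by positivity]
    exact (wnorm_sum_le _ _ _).trans (sum_le_sum fun i _ => hws i)
  have hwu := wnorm_mk_propagatorCoeff_le hΛ.le hB hΛρ
  have heval : realEval s (mk (propagatorCoeff B) - ∑ i, a i • dilate (c i) (stepsSeries B (k i))) =
      realEval s (mk (propagatorCoeff B)) - ∑ i, a i • orderedProd (fun q : ℕ =>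
        NormedSpace.exp ((s / k i) • realEval (s / k i * (q + 1 / 2)) (mk B))) (k i) := by
    rw [realEval_sub (ne_top_of_le_ne_top ENNReal.ofReal_ne_top hwu)
      (ne_top_of_le_ne_top ENNReal.ofReal_ne_top hwsum) hsabs, realEval_sum _
      (fun i _ => ne_top_of_le_ne_top ENNReal.ofReal_ne_top (hws i)) hsabs]
    congr 1
    refine sum_congr rfl fun i _ => ?_
    have hci : s * (c i : ℝ) = s / k i := by rw [hc, div_eq_mul_inv]; push_cast; rfl
    rw [realEval_smul, realEval_dilate, hci, realEval_stepsSeries hΛ.le hB (hk i) (hcρ i) _ le_rfl]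
    rw [← hci, abs_mul, NNReal.abs_eq]
    push_cast
    gcongr
  rw [← heval]
  have hs' : s / ρ = 2 * Λ * s := by rw [hρ]; field_simp
  rw [← hs']
  refine norm_realEval_le (by positivity) ?_ hs0 hsρ hρ0 ?_
  · rw [ENNReal.ofReal_add (by norm_num) (by positivity)]
    exact (wnorm_sub_le _ _ _).trans (add_le_add hwu hwsum)
  · intro j hj
    rw [map_sub, map_sum, coeff_mk, sub_eq_zero,
      ← sum_smul_coeff_stepsSeries B hM hk hV (by omega : j ≤ 2 * M)]
    refine sum_congr rfl fun i _ => ?_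
    rw [coeff_smul, coeff_dilate, hc]
    push_cast
    rfl

theorem hasDerivAt_realEval_propagatorCoeff {B : ℕ → R} {Λ : ℝ} (hΛ : 0 < Λ)
    (hB : ∀ p : ℕ, ‖B p‖ ≤ Λ ^ (p + 1) / p.factorial) {s : ℝ} (hs : Λ * |s| < 1 / 2) :
    HasDerivAt (fun x => realEval x (mk (propagatorCoeff B)))
      (realEval s (mk B) * realEval s (mk (propagatorCoeff B))) s := by
  set r : ℝ := 1 / (2 * Λ) with hr
  have hr0 : 0 < r := by positivity
  have hΛr : Λ * r = 1 / 2 := by rw [hr]; field_simp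
  have hsr : s ∈ Set.Ioo (-r) r := by
    rw [Set.mem_Ioo, ← abs_lt, ← mul_lt_mul_iff_right₀ hΛ, hΛr]; exact hs
  -- Since Λr = 1/2, the majorant is n 2^(-n)/r, which justifies differentiating term by term on
  -- (-r, r).
  have hbound : Summable fun n : ℕ => (n : ℝ) * (Λ ^ n * r ^ (n - 1)) := by
    have h1 : Summable fun n : ℕ => (n : ℝ) ^ 1 * (1 / 2 : ℝ) ^ n :=
      summable_pow_mul_geometric_of_norm_lt_one 1 (by norm_num)
    refine (h1.mul_left r⁻¹).congr fun n => ?_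
    rw [← hΛr]
    cases n with
    | zero => simp
    | succ n => rw [mul_pow, Nat.add_sub_cancel, pow_succ r]; field_simp
  have key := hasDerivAt_tsum_of_isPreconnected (𝕜 := ℝ)
    (g := fun (n : ℕ) (x : ℝ) => x ^ n • propagatorCoeff B n)
    (g' := fun (n : ℕ) (x : ℝ) => ((n : ℝ) * x ^ (n - 1)) • propagatorCoeff B n) (y₀ := 0) hbound
    (isOpen_Ioo (a := -r) (b := r)) isPreconnected_Ioo
    (fun n y _ => (hasDerivAt_pow n y).smul_const _)
    (fun n y hy => by
      have hy' : |y| ≤ r := abs_le.2 ⟨hy.1.le, hy.2.le⟩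
      rw [norm_smul, norm_mul, norm_pow, Real.norm_natCast, Real.norm_eq_abs, mul_assoc,
        mul_comm (Λ ^ n)]
      gcongr
      exact norm_propagatorCoeff_le hΛ.le hB n)
    (by constructor <;> linarith)
    (summable_of_ne_finset_zero (s := {0}) fun n hn => by
      rw [zero_pow (by simpa using hn), zero_smul]) hsr
  have hρabs : |s| ≤ ((⟨r, hr0.le⟩ : ℝ≥0) : ℝ) := abs_le.2 ⟨hsr.1.le, hsr.2.le⟩
  have e1 : (fun x => realEval x (mk (propagatorCoeff B))) =
      fun z : ℝ => ∑' n : ℕ, z ^ n • propagatorCoeff B n := by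
    funext x; simp only [realEval, coeff_mk]
  have hsum : Summable fun n : ℕ => ((n : ℝ) * s ^ (n - 1)) • propagatorCoeff B n := by
    refine Summable.of_norm_bounded hbound fun n => ?_
    rw [norm_smul, norm_mul, norm_pow, Real.norm_natCast, Real.norm_eq_abs, mul_assoc,
      mul_comm (Λ ^ n)]
    have hsr' : |s| ≤ r := hρabs
    gcongr
    exact norm_propagatorCoeff_le hΛ.le hB n
  rw [e1, ← realEval_mul (ρ := ⟨r, hr0.le⟩)
    (ne_top_of_le_ne_top ENNReal.ofReal_ne_top (wnorm_mk_le hΛ.le hB hΛr.le))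
    (ne_top_of_le_ne_top ENNReal.ofReal_ne_top (wnorm_mk_propagatorCoeff_le hΛ.le hB hΛr.le)) hρabs]
  refine key.congr_deriv ?_
  rw [hsum.tsum_eq_zero_add, realEval]
  simp only [Nat.cast_zero, zero_mul, zero_smul, zero_add]
  refine tsum_congr fun n => ?_
  rw [← succ_smul_propagatorCoeff, smul_smul, Nat.add_sub_cancel, mul_comm]
  push_cast
  rfl

end Convergence

/-! ### Error bound for Hermitian Hamiltonians -/

section Hamiltonian

open Finset PowerSeries
open scoped NNReal

variable {ι : Type*} [Fintype ι] [DecidableEq ι]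

/-- The derivative of X*Y is X*(iH - iH)Y = 0. Taking X = Y gives unitarity of the propagator, and
taking two propagators gives uniqueness. -/
theorem star_mul_eq_of_hasDerivWithinAt {H X Y : ℝ → Matrix ι ι ℂ} {t₀ t₁ : ℝ} (h01 : t₀ ≤ t₁)
    (hH : ∀ t ∈ Set.Icc t₀ t₁, (H t).IsHermitian)
    (hX : ∀ t ∈ Set.Icc t₀ t₁,
      HasDerivWithinAt X (-Complex.I • (H t * X t)) (Set.Icc t₀ t₁) t)
    (hY : ∀ t ∈ Set.Icc t₀ t₁,
      HasDerivWithinAt Y (-Complex.I • (H t * Y t)) (Set.Icc t₀ t₁) t) :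
    star (X t₁) * Y t₁ = star (X t₀) * Y t₀ := by
  have hder : ∀ t ∈ Set.Icc t₀ t₁,
      HasDerivWithinAt (fun t => star (X t) * Y t) 0 (Set.Icc t₀ t₁) t := by
    intro t ht
    refine ((hX t ht).star.mul (hY t ht)).congr_deriv ?_
    have hs : star (H t) = H t := hH t ht
    rw [star_smul, star_mul, hs, star_neg, Complex.star_def, Complex.conj_I]
    simp [mul_assoc]
  exact constant_of_has_deriv_right_zero (fun t ht => (hder t ht).continuousWithinAt)
    (fun t ht => (hder t (Set.Ico_subset_Icc_self ht)).mono_of_mem_nhdsWithin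
      (Icc_mem_nhdsGE_of_mem ht)) t₁ (Set.right_mem_Icc.2 h01)

theorem star_mul_self_of_isPropagator {H U : ℝ → Matrix ι ι ℂ} {t₀ t₁ : ℝ} (h01 : t₀ ≤ t₁)
    (hH : ∀ t ∈ Set.Icc t₀ t₁, (H t).IsHermitian) (hU : IsPropagator H t₀ t₁ U) :
    star (U t₁) * U t₁ = 1 := by
  rw [star_mul_eq_of_hasDerivWithinAt h01 hH hU.2 hU.2, hU.1, star_one, one_mul]

theorem IsPropagator.unique {H U V : ℝ → Matrix ι ι ℂ} {t₀ t₁ : ℝ} (h01 : t₀ ≤ t₁)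
    (hH : ∀ t ∈ Set.Icc t₀ t₁, (H t).IsHermitian) (hU : IsPropagator H t₀ t₁ U)
    (hV : IsPropagator H t₀ t₁ V) : U t₁ = V t₁ := by
  have h1 : star (U t₁) * V t₁ = 1 := by
    rw [star_mul_eq_of_hasDerivWithinAt h01 hH hU.2 hV.2, hU.1, hV.1, star_one, one_mul]
  have h2 := mul_eq_one_comm.1 (star_mul_self_of_isPropagator h01 hH hU)
  calc U t₁ = U t₁ * (star (U t₁) * V t₁) := by rw [h1, mul_one]
    _ = V t₁ := by rw [← mul_assoc, h2, one_mul]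

theorem norm_eq_one_of_star_mul_self [Nonempty ι] {A : Matrix ι ι ℂ} (h : star A * A = 1) :
    ‖A‖ = 1 := by
  have h1 := CStarRing.norm_star_mul_self (x := A)
  rw [h, CStarRing.norm_one] at h1
  nlinarith [norm_nonneg A]

theorem norm_midpointFormula [Nonempty ι] {H : ℝ → Matrix ι ι ℂ} {t s : ℝ}
    (h : (H (s + (t - s) / 2)).IsHermitian) : ‖midpointFormula H t s‖ = 1 := by
  refine norm_eq_one_of_star_mul_self ?_
  let _ : NormedAlgebra ℚ (Matrix ι ι ℂ) := NormedAlgebra.restrictScalars ℚ ℂ _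
  refine (Unitary.mem_iff.1 (NormedSpace.exp_mem_unitary_of_mem_skewAdjoint ?_)).1
  rw [skewAdjoint.mem_iff, star_smul, star_mul', star_neg, Complex.star_def, Complex.conj_I,
    Complex.conj_ofReal, show star (H (s + (t - s) / 2)) = H (s + (t - s) / 2) from h]
  rw [← neg_smul]
  congr 1
  ring

theorem norm_orderedProd_le {A : Type*} [NormedRing A] [NormOneClass A] {f : ℕ → A} {n : ℕ}
    (h : ∀ q < n, ‖f q‖ ≤ 1) : ‖orderedProd f n‖ ≤ 1 := by
  induction n with
  | zero => simp [orderedProd]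
  | succ n ih =>
    refine (norm_mul_le _ _).trans (mul_le_one₀ (h n (Nat.lt_succ_self n)) (norm_nonneg _) ?_)
    exact ih fun q hq => h q (hq.trans (Nat.lt_succ_self n))

theorem midpoint_arguments {k : ℕ} (hk : 0 < k) (t₀ Δt : ℝ) (q : ℕ) :
    (t₀ + Δt * ((q : ℝ) + 1) / k) - (t₀ + Δt * (q : ℝ) / k) = Δt / k ∧
    t₀ + Δt * (q : ℝ) / k + ((t₀ + Δt * ((q : ℝ) + 1) / k) - (t₀ + Δt * (q : ℝ) / k)) / 2 =
      t₀ + Δt / k * (q + 1 / 2) := by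
  have : (k : ℝ) ≠ 0 := by exact_mod_cast hk.ne'
  constructor <;> field_simp <;> ring

theorem midpoint_mem {k : ℕ} {Δt : ℝ} (hΔ : 0 ≤ Δt) {q : ℕ} (hq : q < k) :
    0 ≤ Δt / k * (q + 1 / 2) ∧ Δt / k * (q + 1 / 2) ≤ Δt := by
  have hk : (0 : ℝ) < k := by exact_mod_cast (Nat.zero_le q).trans_lt hq
  have hq' : (q : ℝ) + 1 ≤ k := by exact_mod_cast hq
  refine ⟨by positivity, ?_⟩
  rw [div_mul_eq_mul_div, div_le_iff₀ hk]
  gcongr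
  linarith

theorem norm_midpointSteps_le [Nonempty ι] {H : ℝ → Matrix ι ι ℂ} {t₀ Δt : ℝ} (hΔ : 0 ≤ Δt)
    (hH : ∀ t ∈ Set.Icc t₀ (t₀ + Δt), (H t).IsHermitian) {k : ℕ} (hk : 0 < k) :
    ‖midpointSteps H k t₀ Δt‖ ≤ 1 := by
  refine norm_orderedProd_le fun q hq => (norm_midpointFormula ?_).le
  rw [(midpoint_arguments hk t₀ Δt q).2]
  have := midpoint_mem hΔ hq
  exact hH _ ⟨by linarith, by linarith⟩

theorem norm_iteratedDerivWithin_le {H : ℝ → Matrix ι ι ℂ} {I : Set ℝ} {Λ : ℝ → ℝ} {Λmax : ℝ}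
    (hΛ : IsLambdaBound H I Λ) (hmax : IsGreatest (Λ '' I) Λmax) {t : ℝ} (ht : t ∈ I) (j : ℕ) :
    ‖iteratedDerivWithin j H I t‖ ≤ Λmax ^ (j + 1) := by
  have h1 : ‖iteratedDerivWithin j H I t‖ ^ ((1 : ℝ) / ((j : ℝ) + 1)) ≤ Λmax :=
    (hΛ t ht j).trans (hmax.2 (Set.mem_image_of_mem _ ht))
  have h2 := pow_le_pow_left₀ (Real.rpow_nonneg (norm_nonneg _) _) h1 (j + 1)
  rw [← Real.rpow_natCast, ← Real.rpow_mul (norm_nonneg _)] at h2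
  push_cast at h2
  rwa [one_div_mul_cancel (by positivity), Real.rpow_one] at h2

/-- The Taylor coefficients of `-i H` at `t₀`. -/
noncomputable def hamiltonianCoeff (H : ℝ → Matrix ι ι ℂ) (I : Set ℝ) (t₀ : ℝ) (p : ℕ) :
    Matrix ι ι ℂ :=
  (p.factorial : ℝ)⁻¹ • (-Complex.I • iteratedDerivWithin p H I t₀)

theorem norm_hamiltonianCoeff_le {H : ℝ → Matrix ι ι ℂ} {I : Set ℝ} {Λ : ℝ → ℝ} {Λmax : ℝ}
    (hΛ : IsLambdaBound H I Λ) (hmax : IsGreatest (Λ '' I) Λmax) {t₀ : ℝ} (ht : t₀ ∈ I) (p : ℕ) :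
    ‖hamiltonianCoeff H I t₀ p‖ ≤ Λmax ^ (p + 1) / p.factorial := by
  rw [hamiltonianCoeff, norm_smul, norm_smul, norm_neg, Complex.norm_I, one_mul, norm_inv,
    Real.norm_natCast, inv_mul_eq_div]
  gcongr
  exact norm_iteratedDerivWithin_le hΛ hmax ht p

/-- Derivatives of size Λ^(n+1) lose to the factorial in Taylor's remainder, so smoothness together
with the Λ-bound makes H equal to its Taylor series at t₀. -/
theorem realEval_hamiltonianCoeff {H : ℝ → Matrix ι ι ℂ} {t₀ Δt : ℝ} (hΔ : 0 < Δt)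
    (hH : ContDiffOn ℝ ∞ H (Set.Icc t₀ (t₀ + Δt))) {Λ : ℝ → ℝ} {Λmax : ℝ} (h0 : 0 < Λmax)
    (hΛ : IsLambdaBound H (Set.Icc t₀ (t₀ + Δt)) Λ)
    (hmax : IsGreatest (Λ '' Set.Icc t₀ (t₀ + Δt)) Λmax) (hx : Λmax * Δt ≤ 1 / 2) {s : ℝ}
    (hs : s ∈ Set.Icc 0 Δt) :
    realEval s (mk (hamiltonianCoeff H (Set.Icc t₀ (t₀ + Δt)) t₀)) =
      -Complex.I • H (t₀ + s) := by
  set I := Set.Icc t₀ (t₀ + Δt) with hI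
  have ht0 : t₀ ∈ I := ⟨le_rfl, by linarith⟩
  have hts : t₀ + s ∈ I := ⟨by linarith [hs.1], by linarith [hs.2]⟩
  have hrem : ∀ n : ℕ, ‖H (t₀ + s) - taylorWithinEval H n I t₀ (t₀ + s)‖ ≤
      Λmax * ((Λmax * s) ^ (n + 1) / n.factorial) := by
    intro n
    have h := taylor_mean_remainder_bound (by linarith : t₀ ≤ t₀ + Δt)
      (hH.of_le (by exact_mod_cast le_top) : ContDiffOn ℝ (n + 1) H I) hts
      (fun y hy => norm_iteratedDerivWithin_le hΛ hmax hy (n + 1))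
    refine h.trans (le_of_eq ?_)
    rw [add_sub_cancel_left]
    ring
  have hlim : Tendsto (fun n => taylorWithinEval H n I t₀ (t₀ + s)) atTop (nhds (H (t₀ + s))) := by
    rw [tendsto_iff_norm_sub_tendsto_zero]
    have h1 : Tendsto (fun n : ℕ => Λmax * ((Λmax * s) ^ (n + 1) / n.factorial)) atTop (nhds 0) := by
      have h2 := (FloorSemiring.tendsto_pow_div_factorial_atTop (Λmax * s)).const_mul
        (Λmax * (Λmax * s))
      rw [mul_zero] at h2
      refine h2.congr fun n => ?_
      rw [pow_succ]; ring
    refine squeeze_zero (fun _ => norm_nonneg _) (fun n => ?_) h1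
    rw [norm_sub_rev]
    exact hrem n
  have hsum : Summable fun n => s ^ n • coeff n (mk (hamiltonianCoeff H I t₀)) := by
    have hB := norm_hamiltonianCoeff_le hΛ hmax ht0
    have hw := wnorm_mk_le (ρ := ⟨Δt, hΔ.le⟩) h0.le hB hx
    refine (summable_norm_of_wnorm (ne_top_of_le_ne_top ENNReal.ofReal_ne_top hw) ?_).of_norm
    rw [abs_of_nonneg hs.1]
    exact hs.2
  have hpart : ∀ n : ℕ, ∑ p ∈ range (n + 1), s ^ p • coeff p (mk (hamiltonianCoeff H I t₀)) =
      -Complex.I • taylorWithinEval H n I t₀ (t₀ + s) := by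
    intro n
    rw [taylor_within_apply, smul_sum]
    refine sum_congr rfl fun p _ => ?_
    rw [coeff_mk, hamiltonianCoeff, add_sub_cancel_left, smul_smul, smul_comm, mul_comm]
  have ht := (tendsto_add_atTop_iff_nat 1).2 hsum.hasSum.tendsto_sum_nat
  simp only [hpart] at ht
  exact tendsto_nhds_unique ht (hlim.const_smul _)

theorem norm_sub_multiproductFormula_le [Nonempty ι] {H : ℝ → Matrix ι ι ℂ} {t₀ Δt : ℝ}
    (hΔ : 0 < Δt) (hherm : ∀ t ∈ Set.Icc t₀ (t₀ + Δt), (H t).IsHermitian)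
    (hH : ContDiffOn ℝ ∞ H (Set.Icc t₀ (t₀ + Δt))) {Λ : ℝ → ℝ} {Λmax : ℝ} (h0 : 0 < Λmax)
    (hΛ : IsLambdaBound H (Set.Icc t₀ (t₀ + Δt)) Λ)
    (hmax : IsGreatest (Λ '' Set.Icc t₀ (t₀ + Δt)) Λmax) (hx : Λmax * Δt < 1 / 2)
    {U : ℝ → Matrix ι ι ℂ} (hU : IsPropagator H t₀ (t₀ + Δt) U) {M : ℕ} (hM : 1 ≤ M)
    {k : Fin M → ℕ} {a : Fin M → ℝ} (hk : ∀ i, 0 < k i) (hV : SatisfiesVandermonde k a) :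
    ‖U (t₀ + Δt) - multiproductFormula H k a t₀ Δt‖ ≤
      (2 * Λmax * Δt) ^ (2 * M + 1) * (2 + 3 * ∑ i, |a i|) := by
  set I := Set.Icc t₀ (t₀ + Δt) with hI
  set B := hamiltonianCoeff H I t₀
  have hB := norm_hamiltonianCoeff_le hΛ hmax (⟨le_rfl, by linarith⟩ : t₀ ∈ I)
  have hA : ∀ s ∈ Set.Icc 0 Δt, realEval s (mk B) = -Complex.I • H (t₀ + s) := fun s hs =>
    realEval_hamiltonianCoeff hΔ hH h0 hΛ hmax hx.le hs
  -- The series built from `propagatorCoeff` solves the initial value problem, so uniqueness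
  -- identifies its endpoint value with that of U.
  have hVprop : IsPropagator H t₀ (t₀ + Δt)
      (fun t => realEval (t - t₀) (mk (propagatorCoeff B))) := by
    constructor
    · change realEval (t₀ - t₀) _ = 1
      rw [sub_self, realEval, tsum_eq_single 0]
      · simp [propagatorCoeff]
      · intro n hn
        rw [zero_pow hn, zero_smul]
    · intro t ht
      have hs : t - t₀ ∈ Set.Icc 0 Δt := ⟨by linarith [ht.1], by linarith [ht.2]⟩
      have h1 : Λmax * |t - t₀| < 1 / 2 := by
        rw [abs_of_nonneg hs.1]
        exact (mul_le_mul_of_nonneg_left hs.2 h0.le).trans_lt hx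
      have h2 := (hasDerivAt_realEval_propagatorCoeff h0 hB h1).comp_sub_const t t₀
      rw [hA _ hs, add_sub_cancel, smul_mul_assoc] at h2
      exact h2.hasDerivWithinAt
  have hUV := hU.unique (by linarith) hherm hVprop
  have hmp : multiproductFormula H k a t₀ Δt = ∑ i, a i • orderedProd (fun q : ℕ =>
      NormedSpace.exp ((Δt / k i) • realEval (Δt / k i * (q + 1 / 2)) (mk B))) (k i) := by
    have hcongr : ∀ {f g : ℕ → Matrix ι ι ℂ} {n : ℕ}, (∀ q < n, f q = g q) →
        orderedProd f n = orderedProd g n := by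
      intro f g n hfg
      induction n with
      | zero => rfl
      | succ n ih =>
        rw [orderedProd, orderedProd, hfg n (Nat.lt_succ_self n),
          ih fun q hq => hfg q (hq.trans (Nat.lt_succ_self n))]
    refine sum_congr rfl fun i _ => ?_
    rw [Complex.coe_smul, midpointSteps]
    congr 1
    refine hcongr fun q hq => ?_
    have hargs := midpoint_arguments (hk i) t₀ Δt q
    rw [midpointFormula, hargs.2, hargs.1, hA _ (midpoint_mem hΔ.le hq), mul_comm, mul_smul,
      Complex.coe_smul]
  have key := norm_realEval_sub_multiproduct_le h0 hB hM hk hV hΔ.le hx.le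
  rw [hUV, hmp]
  simpa using key

theorem norm_sub_multiproductFormula_lt [Nonempty ι] {H : ℝ → Matrix ι ι ℂ} {t₀ Δt : ℝ}
    (hΔ : 0 < Δt) (hherm : ∀ t ∈ Set.Icc t₀ (t₀ + Δt), (H t).IsHermitian)
    (hH : ContDiffOn ℝ ∞ H (Set.Icc t₀ (t₀ + Δt))) {Λ : ℝ → ℝ} {Λmax : ℝ} (h0 : 0 < Λmax)
    (hΛ : IsLambdaBound H (Set.Icc t₀ (t₀ + Δt)) Λ)
    (hmax : IsGreatest (Λ '' Set.Icc t₀ (t₀ + Δt)) Λmax)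
    {U : ℝ → Matrix ι ι ℂ} (hU : IsPropagator H t₀ (t₀ + Δt) U) {M : ℕ} (hM : 1 ≤ M)
    {k : Fin M → ℕ} {a : Fin M → ℝ} (hk : ∀ i, 0 < k i) (hV : SatisfiesVandermonde k a) :
    ‖U (t₀ + Δt) - multiproductFormula H k a t₀ Δt‖ <
      0.32 * (∑ i, |a i|) * (41 * Λmax * Δt) ^ (2 * M + 1) := by
  have ha : 1 ≤ ∑ i, |a i| := by
    have h1 := hV 0 hM
    simp only [mul_zero, pow_zero, inv_one, mul_one, if_true] at h1
    rw [← h1]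
    exact sum_le_sum fun i _ => le_abs_self _
  have hx0 : 0 < Λmax * Δt := mul_pos h0 hΔ
  -- The threshold is the convergence radius used above. Below it, 2 + 3‖a‖₁ ≤ 5‖a‖₁ is beaten by
  -- 0.32 (41/2)³‖a‖₁. Above it, 41ΛΔt ≥ 41/2 and the error is at most 1 + ‖a‖₁ ≤ 2‖a‖₁.
  rcases lt_or_ge (Λmax * Δt) (1 / 2) with hx | hx
  · refine (norm_sub_multiproductFormula_le hΔ hherm hH h0 hΛ hmax hx hU hM hk hV).trans_lt ?_
    have h1 : (41 * Λmax * Δt) ^ (2 * M + 1) =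
        (41 / 2) ^ (2 * M + 1) * (2 * Λmax * Δt) ^ (2 * M + 1) := by
      rw [← mul_pow]; congr 1; ring
    have h2 : (41 / 2 : ℝ) ^ 3 ≤ (41 / 2) ^ (2 * M + 1) :=
      pow_le_pow_right₀ (by norm_num) (by omega)
    have h3 : 0 < (2 * Λmax * Δt) ^ (2 * M + 1) := by positivity
    rw [h1]
    have h4 : 2 + 3 * ∑ i, |a i| < 0.32 * (∑ i, |a i|) * (41 / 2) ^ (2 * M + 1) := by
      calc 2 + 3 * ∑ i, |a i| ≤ 5 * ∑ i, |a i| := by linarith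
        _ < 0.32 * (∑ i, |a i|) * (41 / 2) ^ 3 := by norm_num; linarith
        _ ≤ _ := by gcongr
    calc (2 * Λmax * Δt) ^ (2 * M + 1) * (2 + 3 * ∑ i, |a i|)
        < (2 * Λmax * Δt) ^ (2 * M + 1) * (0.32 * (∑ i, |a i|) * (41 / 2) ^ (2 * M + 1)) := by
          gcongr
      _ = _ := by ring
  · have hU1 : ‖U (t₀ + Δt)‖ = 1 :=
      norm_eq_one_of_star_mul_self (star_mul_self_of_isPropagator (by linarith) hherm hU)
    have hmp : ‖multiproductFormula H k a t₀ Δt‖ ≤ ∑ i, |a i| := by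
      refine (norm_sum_le _ _).trans (sum_le_sum fun i _ => ?_)
      rw [norm_smul, Complex.norm_real, Real.norm_eq_abs]
      exact mul_le_of_le_one_right (abs_nonneg _) (norm_midpointSteps_le hΔ.le hherm (hk i))
    have h1 : (41 / 2 : ℝ) ^ 3 ≤ (41 * Λmax * Δt) ^ (2 * M + 1) := by
      have h2 : (41 / 2 : ℝ) ≤ 41 * Λmax * Δt := by rw [mul_assoc]; linarith
      calc (41 / 2 : ℝ) ^ 3 ≤ (41 / 2) ^ (2 * M + 1) := pow_le_pow_right₀ (by norm_num) (by omega)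
        _ ≤ _ := by gcongr
    calc ‖U (t₀ + Δt) - multiproductFormula H k a t₀ Δt‖
        ≤ 1 + ∑ i, |a i| := (norm_sub_le _ _).trans (add_le_add hU1.le hmp)
      _ < 0.32 * (∑ i, |a i|) * (41 / 2) ^ 3 := by norm_num; linarith
      _ ≤ _ := by gcongr

end Hamiltonian

theorem mainTheorem1 :
    ∃ (k : (M : ℕ) → Fin M → ℕ) (a : (M : ℕ) → Fin M → ℝ),
      ((fun M : ℕ => ∑ j, |a M j|) =O[atTop] fun M : ℕ => Real.log (M : ℝ)) ∧
      ((fun M : ℕ => ((Finset.univ.sup (k M) : ℕ) : ℝ)) =O[atTop] fun M : ℕ => (M : ℝ) ^ 2) ∧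
      ∀ M : ℕ, 1 ≤ M →
        (∀ j, 0 < k M j) ∧ SatisfiesVandermonde (k M) (a M) ∧
        ∀ (n : ℕ) (t₀ Δt : ℝ), 0 < Δt →
        ∀ H : ℝ → Matrix (Fin (2 ^ n)) (Fin (2 ^ n)) ℂ,
          (∀ t ∈ Set.Icc t₀ (t₀ + Δt), (H t).IsHermitian) →
          ContDiffOn ℝ ∞ H (Set.Icc t₀ (t₀ + Δt)) →
        ∀ (Λ : ℝ → ℝ) (Λmax : ℝ),
          IsLambdaBound H (Set.Icc t₀ (t₀ + Δt)) Λ →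
          IsGreatest (Λ '' Set.Icc t₀ (t₀ + Δt)) Λmax → 0 < Λmax →
        ∀ U : ℝ → Matrix (Fin (2 ^ n)) (Fin (2 ^ n)) ℂ,
          IsPropagator H t₀ (t₀ + Δt) U →
          ‖U (t₀ + Δt) - multiproductFormula H (k M) (a M) t₀ Δt‖ <
            0.32 * (∑ j, |a M j|) * (41 * Λmax * Δt) ^ (2 * M + 1) :=
  ⟨stepNumber, stepWeight, sum_abs_stepWeight_isBigO, sup_stepNumber_isBigO, fun M hM =>
    ⟨stepNumber_pos M, satisfiesVandermonde_stepWeight M,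
      fun _ _ _ hΔ _ hherm hH _ _ hΛ hmax h0 _ hU =>
        norm_sub_multiproductFormula_lt hΔ hherm hH h0 hΛ hmax hU hM (stepNumber_pos M)
          (satisfiesVandermonde_stepWeight M)⟩⟩
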